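/- **Theorem (Nyström approximation: sharp upper and lower bounds).** Let $\mathbb{K}\in\{\mathbb{R},\mathbb{C}\}$, and set $\alpha_{\mathbb{R}}=1$, $\alpha_{\mathbb{C}}=0$. Let $\Omega\in\mathbb{K}^{n\times\ell}$, $\ell\le n$, be a random matrix with $\operatorname{rank}(\Omega)=\ell$ almost surely (a full-rank random embedding). For a positive-semidefinite (psd) matrix $H\in\mathbb{K}^{n\times n}$, let $$H\langle\Omega\rangle = H\Omega\,(\Omega^*H\Omega)^+\,\Omega^*H$$ be the Nyström approximation, where ${}^*$ is the adjoint and ${}^+$ is the Moore–Penrose pseudoinverse, and let $[\![H]\!]_q$ be an optimal rank-$q$ approximation of $H$, generated by a $q$-truncated singular value decomposition. The random variable $\operatorname{tr}(H-H\langle\Omega\rangle)$ is integrable for every psd $H$, and the following bounds hold, with $q$ ranging over the nonnegative integers. (a) *Sharp upper bound.* Assume that $U\Omega$ has the same distribution as $\Omega$ for each unitary $U\in\mathbb{K}^{n\times n}$. Then, for any psd $H\in\mathbb{K}^{n\times n}$ with $r=\operatorname{rank}(H)\ge\ell$, $$\mathbb{E}\operatorname{tr}(H-H\langle\Omega\rangle)\;\le\;\min_{q<\ell-\alpha_{\mathbb{K}}}\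 \frac{r-\ell}{r-q}\left(1+\frac{q}{\ell-q-\alpha_{\mathbb{K}}}\right)\operatorname{tr}(H-[\![H]\!]_q),$$ where the minimum over an empty set of $q$ is $+\infty$. (b) *Sharp lower bound.* For all nonnegative integers $q,r$ with $q+\alpha_{\mathbb{K}}<\ell\le r\le n$, $$\sup_{\substack{H\in\mathbb{K}^{n\times n}\text{ psd}\\ \operatorname{rank}(H)=r}}\frac{\mathbb{E}\operatorname{tr}(H-H\langle\Omega\rangle)}{\operatorname{tr}(H-[\![H]\!]_q)}\;\ge\;\frac{r-\ell}{r-q}\left(1+\frac{q}{\ell-q-\alpha_{\mathbb{K}}}\right),$$ where the supremum may be $+\infty$. -/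

import Mathlib

open MeasureTheory ProbabilityTheory
open scoped Matrix ComplexOrder

namespace Nystrom

/-- The entrywise (product, i.e. Borel) σ-algebra on matrices. -/
instance matrixMeasurableSpace {m n 𝕜 : Type*} [MeasurableSpace 𝕜] :
    MeasurableSpace (Matrix m n 𝕜) :=
  inferInstanceAs (MeasurableSpace (m → n → 𝕜))

open Classical in
/-- The field constant `α_𝕜`: it is `1` over the reals and `0` over the complex numbers
(in an `RCLike` field, the imaginary unit `RCLike.I` vanishes exactly in the real case). -/
noncomputable def fieldAlpha (𝕜 : Type*) [RCLike 𝕜] : ℕ :=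
  if (RCLike.I : 𝕜) = 0 then 1 else 0

theorem fieldAlpha_real : fieldAlpha ℝ = 1 := by
  simp [fieldAlpha]

theorem fieldAlpha_complex : fieldAlpha ℂ = 0 := by
  simp [fieldAlpha]

section Pseudoinverse

variable {m n 𝕜 : Type*} [Fintype m] [Fintype n] [RCLike 𝕜]

/-- The four Penrose conditions: `X` is the Moore–Penrose pseudoinverse of `A`. -/
structure IsMoorePenrose (A : Matrix m n 𝕜) (X : Matrix n m 𝕜) : Prop where
  mul_mul_self : A * X * A = A
  mul_mul_inv : X * A * X = X
  isHermitian_left : (A * X).IsHermitian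
  isHermitian_right : (X * A).IsHermitian

theorem IsMoorePenrose.unique {A : Matrix m n 𝕜} {X Y : Matrix n m 𝕜}
    (hX : IsMoorePenrose A X) (hY : IsMoorePenrose A Y) : X = Y := by
  have h1 : A * X = A * Y := by
    have e1 : A * Y * (A * X) = A * X := by
      rw [← Matrix.mul_assoc, hY.mul_mul_self]
    have e2 : A * X * (A * Y) = A * Y := by
      rw [← Matrix.mul_assoc, hX.mul_mul_self]
    have e3 := congrArg Matrix.conjTranspose e1
    rw [Matrix.conjTranspose_mul, hX.isHermitian_left.eq, hY.isHermitian_left.eq] at e3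
    exact e3.symm.trans e2
  have h2 : X * A = Y * A := by
    have e1 : X * A * (Y * A) = X * A := by
      rw [Matrix.mul_assoc, ← Matrix.mul_assoc A, hY.mul_mul_self]
    have e2 : Y * A * (X * A) = Y * A := by
      rw [Matrix.mul_assoc, ← Matrix.mul_assoc A, hX.mul_mul_self]
    have e3 := congrArg Matrix.conjTranspose e1
    rw [Matrix.conjTranspose_mul, hX.isHermitian_right.eq, hY.isHermitian_right.eq] at e3
    exact e3.symm.trans e2
  calc X = X * A * X := hX.mul_mul_inv.symm
    _ = Y * (A * X) := by rw [h2, Matrix.mul_assoc]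
    _ = Y * A * Y := by rw [h1, Matrix.mul_assoc]
    _ = Y := hY.mul_mul_inv

theorem IsMoorePenrose.conjTranspose {A : Matrix m n 𝕜} {X : Matrix n m 𝕜}
    (h : IsMoorePenrose A X) : IsMoorePenrose Aᴴ Xᴴ where
  mul_mul_self := by
    rw [Matrix.mul_assoc, ← Matrix.conjTranspose_mul, ← Matrix.conjTranspose_mul, h.mul_mul_self]
  mul_mul_inv := by
    rw [Matrix.mul_assoc, ← Matrix.conjTranspose_mul, ← Matrix.conjTranspose_mul, h.mul_mul_inv]
  isHermitian_left := by
    rw [← Matrix.conjTranspose_mul]; exact Matrix.isHermitian_conjTranspose_iff.2 h.isHermitian_right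
  isHermitian_right := by
    rw [← Matrix.conjTranspose_mul]; exact Matrix.isHermitian_conjTranspose_iff.2 h.isHermitian_left

theorem exists_isMoorePenrose_of_isHermitian {S : Matrix n n 𝕜} (hS : S.IsHermitian) :
    ∃ X, IsMoorePenrose S X := by
  classical
  obtain ⟨U, hU, D, hD⟩ : ∃ U : Matrix n n 𝕜, Uᴴ * U = 1 ∧ ∃ d : n → ℝ,
      S = U * Matrix.diagonal (fun i => (d i : 𝕜)) * Uᴴ := by
    refine ⟨hS.eigenvectorUnitary, ?_, hS.eigenvalues, ?_⟩
    · exact Matrix.UnitaryGroup.star_mul_self _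
    · conv_lhs => rw [hS.spectral_theorem, Unitary.conjStarAlgAut_apply]
      rfl
  have key : ∀ a b : n → ℝ, (U * Matrix.diagonal (fun i => (a i : 𝕜)) * Uᴴ) *
      (U * Matrix.diagonal (fun i => (b i : 𝕜)) * Uᴴ) =
      U * Matrix.diagonal (fun i => ((a i * b i : ℝ) : 𝕜)) * Uᴴ := by
    intro a b
    calc _ = U * Matrix.diagonal (fun i => (a i : 𝕜)) * (Uᴴ * U) *
          Matrix.diagonal (fun i => (b i : 𝕜)) * Uᴴ := by simp only [Matrix.mul_assoc]
      _ = _ := by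
        rw [hU, Matrix.mul_one, Matrix.mul_assoc U, Matrix.diagonal_mul_diagonal]
        simp
  have herm : ∀ a : n → ℝ, (U * Matrix.diagonal (fun i => (a i : 𝕜)) * Uᴴ).IsHermitian := by
    intro a
    apply Matrix.isHermitian_mul_mul_conjTranspose
    rw [Matrix.isHermitian_diagonal_iff]
    intro i
    simp [IsSelfAdjoint]
  refine ⟨U * Matrix.diagonal (fun i => (((D i)⁻¹ : ℝ) : 𝕜)) * Uᴴ, ?_, ?_, ?_, ?_⟩
  · rw [hD, key, key]
    simp
  · rw [hD, key, key]
    congr! 5 with i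
    by_cases h : D i = 0 <;> simp [h]
  · rw [hD, key]; exact herm _
  · rw [hD, key]; exact herm _

theorem exists_isMoorePenrose (A : Matrix m n 𝕜) : ∃ X, IsMoorePenrose A X := by
  classical
  have hS : (Aᴴ * A).IsHermitian := Matrix.isHermitian_conjTranspose_mul_self A
  obtain ⟨X, hX⟩ := exists_isMoorePenrose_of_isHermitian hS
  have hXh : Xᴴ = X := by
    have h := hX.conjTranspose
    rw [hS.eq] at h
    exact h.unique hX
  have hA : A * (X * (Aᴴ * A)) = A := by
    have h0 : Aᴴ * A * (X * (Aᴴ * A) - 1) = 0 := by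
      rw [Matrix.mul_sub, ← Matrix.mul_assoc, hX.mul_mul_self, Matrix.mul_one, sub_self]
    rw [Matrix.conjTranspose_mul_self_mul_eq_zero, Matrix.mul_sub, Matrix.mul_one, sub_eq_zero] at h0
    exact h0
  refine ⟨X * Aᴴ, ?_, ?_, ?_, ?_⟩
  · calc _ = A * (X * (Aᴴ * A)) := by simp only [Matrix.mul_assoc]
      _ = A := hA
  · calc _ = X * (Aᴴ * A) * X * Aᴴ := by simp only [Matrix.mul_assoc]
      _ = _ := by rw [hX.mul_mul_inv]
  · rw [← Matrix.mul_assoc]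
    exact Matrix.isHermitian_mul_mul_conjTranspose A hXh
  · rw [Matrix.mul_assoc]
    exact hX.isHermitian_right

/-- The Moore–Penrose pseudoinverse: the unique matrix satisfying the Penrose conditions. -/
noncomputable def pinv (A : Matrix m n 𝕜) : Matrix n m 𝕜 :=
  (exists_isMoorePenrose A).choose

theorem isMoorePenrose_pinv (A : Matrix m n 𝕜) : IsMoorePenrose A (pinv A) :=
  (exists_isMoorePenrose A).choose_spec

end Pseudoinverse

section LowRank

variable {n : ℕ} {𝕜 : Type*} [RCLike 𝕜]

/-- `B` is a `q`-truncated singular value decomposition of the square matrix `A`: for some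
singular value decomposition `A = U diag(σ) V*` with `U, V` unitary and `σ₁ ≥ σ₂ ≥ ⋯ ≥ 0`,
the matrix `B` is obtained by setting all but the first `q` singular values to zero. -/
def IsTruncatedSVD (q : ℕ) (A B : Matrix (Fin n) (Fin n) 𝕜) : Prop :=
  ∃ U ∈ Matrix.unitaryGroup (Fin n) 𝕜, ∃ V ∈ Matrix.unitaryGroup (Fin n) 𝕜,
    ∃ σ : Fin n → ℝ, Antitone σ ∧ (∀ i, 0 ≤ σ i) ∧
      A = U * Matrix.diagonal (fun i => (σ i : 𝕜)) * Vᴴ ∧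
      B = U * Matrix.diagonal (fun i : Fin n => if i.val < q then (σ i : 𝕜) else 0) * Vᴴ

theorem exists_isTruncatedSVD (q : ℕ) {H : Matrix (Fin n) (Fin n) 𝕜} (hH : H.PosSemidef) :
    ∃ B, IsTruncatedSVD q H B := by
  let e : Fin n ≃ Fin n :=
    (finCongr (Fintype.card_fin n).symm).trans (Fintype.equivOfCardEq (Fintype.card_fin _))
  let W : Matrix (Fin n) (Fin n) 𝕜 := hH.1.eigenvectorUnitary
  have hW : W * Wᴴ = 1 := Matrix.mem_unitaryGroup_iff.1 hH.1.eigenvectorUnitary.2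
  have hspec : H = W * Matrix.diagonal (fun i => (hH.1.eigenvalues i : 𝕜)) * Wᴴ := by
    conv_lhs => rw [hH.1.spectral_theorem, Unitary.conjStarAlgAut_apply]
    rfl
  have hU : W.submatrix id e ∈ Matrix.unitaryGroup (Fin n) 𝕜 := by
    rw [Matrix.mem_unitaryGroup_iff, Matrix.star_eq_conjTranspose, Matrix.conjTranspose_submatrix,
      Matrix.submatrix_mul_equiv, hW, Matrix.submatrix_id_id]
  refine ⟨_, W.submatrix id e, hU, W.submatrix id e, hU,
    fun i => hH.1.eigenvalues (e i), ?_, fun i => hH.eigenvalues_nonneg _, ?_, rfl⟩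
  · intro i j hij
    simp only [Matrix.IsHermitian.eigenvalues, e, Equiv.trans_apply, Equiv.symm_apply_apply]
    exact hH.1.eigenvalues₀_antitone hij
  · have hd : Matrix.diagonal (fun i => (hH.1.eigenvalues (e i) : 𝕜)) =
        (Matrix.diagonal (fun i => (hH.1.eigenvalues i : 𝕜))).submatrix e e := by
      rw [Matrix.submatrix_diagonal_equiv]
      rfl
    rw [hd, Matrix.conjTranspose_submatrix, Matrix.submatrix_mul_equiv,
      Matrix.submatrix_mul_equiv, Matrix.submatrix_id_id]
    exact hspec

open Classical in
/-- `⟦A⟧_q`: an optimal rank-`q` approximation, generated by a `q`-truncated singular value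
decomposition of `A`. (If the `q`-th singular value is repeated the truncation depends on the
decomposition, but for psd `A` the trace of `A - ⟦A⟧_q` does not.) -/
noncomputable def lowRank (q : ℕ) (A : Matrix (Fin n) (Fin n) 𝕜) : Matrix (Fin n) (Fin n) 𝕜 :=
  if h : ∃ B, IsTruncatedSVD q A B then h.choose else 0

theorem isTruncatedSVD_lowRank (q : ℕ) {H : Matrix (Fin n) (Fin n) 𝕜} (hH : H.PosSemidef) :
    IsTruncatedSVD q H (lowRank q H) := by
  have h := exists_isTruncatedSVD q hH
  rw [lowRank, dif_pos h]
  exact h.choose_spec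

/-- The Nyström approximation `H⟨Ω⟩ = HΩ (Ω* H Ω)⁺ Ω* H`. -/
noncomputable def nystromApprox {ℓ : ℕ} (H : Matrix (Fin n) (Fin n) 𝕜)
    (Ω : Matrix (Fin n) (Fin ℓ) 𝕜) : Matrix (Fin n) (Fin n) 𝕜 :=
  H * Ω * pinv (Ωᴴ * H * Ω) * Ωᴴ * H

/-- The Nyström error `tr(H - H⟨Ω⟩)`, a real number for Hermitian `H`. -/
noncomputable def nystromError {ℓ : ℕ} (H : Matrix (Fin n) (Fin n) 𝕜)
    (Ω : Matrix (Fin n) (Fin ℓ) 𝕜) : ℝ :=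
  RCLike.re (H - nystromApprox H Ω).trace

/-- The optimal error `tr(H - ⟦H⟧_q)`, a real number for psd `H`. -/
noncomputable def optimalError (q : ℕ) (H : Matrix (Fin n) (Fin n) 𝕜) : ℝ :=
  RCLike.re (H - lowRank q H).trace

end LowRank

section Random

variable {Ω' : Type*} [MeasurableSpace Ω'] {n ℓ : ℕ} {𝕜 : Type*} [RCLike 𝕜]

/-- A full-rank random embedding: a random tall matrix (`ℓ ≤ n`) which almost surely has rank `ℓ`. -/
structure IsFullRankRandomEmbedding (P : Measure Ω') (Ω : Ω' → Matrix (Fin n) (Fin ℓ) 𝕜) :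
    Prop where
  le : ℓ ≤ n
  aemeasurable : AEMeasurable Ω P
  rank_eq : ∀ᵐ ω ∂P, (Ω ω).rank = ℓ

/-- Rotation invariance: `UΩ ∼ Ω` in distribution for each unitary `U` (orthogonal if `𝕜 = ℝ`). -/
def IsRotationInvariant (P : Measure Ω') (Ω : Ω' → Matrix (Fin n) (Fin ℓ) 𝕜) : Prop :=
  ∀ U ∈ Matrix.unitaryGroup (Fin n) 𝕜, IdentDistrib (fun ω => U * Ω ω) Ω P P

end Random

/-- The constant `(r - ℓ)/(r - q) · (1 + q/(ℓ - q - α))`. -/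
noncomputable def sharpConst (α q r ℓ : ℕ) : ℝ :=
  ((r : ℝ) - ℓ) / ((r : ℝ) - q) * (1 + (q : ℝ) / ((ℓ : ℝ) - q - α))

end Nystrom

/-! For a diagonal psd matrix with entries c, the error is the sum over j of D_j, the squared
c-weighted distance from the coordinate vector e_j to the range of Ω (`nystromError_diagonal`). An
infimum of functions linear in c is monotone, homogeneous and superadditive in c, hence concave.
When Ω is rotation invariant, every psd matrix may be taken diagonal and the expected error is
symmetric in the eigenvalues.

Upper bound: averaging the nonzero eigenvalues after the first q over all their permutations can
only increase the expected error (`IsUnitaryInvariant.expectedError_le_average`) and keeps the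
optimal error. Raising the first q to one large common value increases it again. So the worst case
is a spiked spectrum: t on a set Q of q indices, 1 on a set T of r - q indices, 0 elsewhere.

For a spiked spectrum, the sum of D_j / c_j over the nonzero c_j is a trace of identity minus
projection, namely r - ℓ, so the error is (r - ℓ) + (1 - 1/t) times the sum of D_j over Q
(`sum_weightedDist_penaltyWeight`). For j in Q, 1/D_j - 1/c_j does not depend on c_j
(`weightedDist_update`). Resetting c_j to 1 gives a distance δ, and D_j converges to δ/(1 - δ) with
δ replaced by its limit, as t grows. That limit is the squared distance from e_j to a random
subspace V of dimension ℓ - q + 1 in 𝕜^(T ∪ {j}). By invariance e_j may be replaced by a Gaussian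
vector x, whose components along V and orthogonal to V are independent. The expected ratio is thus
E‖x_⊥‖² · E‖x_∥‖⁻² = (r - ℓ)/(ℓ - q - α) (`lintegral_projection_ratio`), where α enters through the
real dimension of 𝕜. This bounds the error for every t and is attained in the limit.

Lower bound: Ω need not be invariant, but a Haar rotation of it is. The error of the rotated
embedding on the spiked matrix is an average of errors of Ω on unitary conjugates of that matrix
(`expectedError_randomRotation_le`), so the supremum over conjugates is at least this average. -/

namespace Nystrom

/-! ### Weighted distance to the column space -/

section WeightedDist

variable {ι κ 𝕜 : Type*} [Fintype ι] [Fintype κ] [RCLike 𝕜]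

/-- The squared distance from `x` to the column space of `Ω`, in the seminorm with weights `c`. -/
noncomputable def weightedDist (c : ι → ℝ) (Ω : Matrix ι κ 𝕜) (x : ι → 𝕜) : ℝ :=
  ⨅ w : κ → 𝕜, ∑ i, c i * ‖x i - (Ω *ᵥ w) i‖ ^ 2

theorem weightedDist_bddBelow {c : ι → ℝ} (hc : ∀ i, 0 ≤ c i) (Ω : Matrix ι κ 𝕜) (x : ι → 𝕜) :
    BddBelow (Set.range fun w : κ → 𝕜 => ∑ i, c i * ‖x i - (Ω *ᵥ w) i‖ ^ 2) :=
  ⟨0, by rintro _ ⟨w, rfl⟩; exact Finset.sum_nonneg fun i _ => mul_nonneg (hc i) (sq_nonneg _)⟩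

theorem weightedDist_nonneg {c : ι → ℝ} (hc : ∀ i, 0 ≤ c i) (Ω : Matrix ι κ 𝕜) (x : ι → 𝕜) :
    0 ≤ weightedDist c Ω x :=
  Real.iInf_nonneg fun _ => Finset.sum_nonneg fun i _ => mul_nonneg (hc i) (sq_nonneg _)

theorem weightedDist_le {c : ι → ℝ} (hc : ∀ i, 0 ≤ c i) (Ω : Matrix ι κ 𝕜) (x : ι → 𝕜)
    (w : κ → 𝕜) : weightedDist c Ω x ≤ ∑ i, c i * ‖x i - (Ω *ᵥ w) i‖ ^ 2 :=
  ciInf_le (weightedDist_bddBelow hc Ω x) w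

theorem weightedDist_le_self {c : ι → ℝ} (hc : ∀ i, 0 ≤ c i) (Ω : Matrix ι κ 𝕜) (x : ι → 𝕜) :
    weightedDist c Ω x ≤ ∑ i, c i * ‖x i‖ ^ 2 := by
  simpa using weightedDist_le hc Ω x 0

theorem weightedDist_mono {c d : ι → ℝ} (hc : ∀ i, 0 ≤ c i) (hcd : ∀ i, c i ≤ d i)
    (Ω : Matrix ι κ 𝕜) (x : ι → 𝕜) : weightedDist c Ω x ≤ weightedDist d Ω x :=
  ciInf_mono (weightedDist_bddBelow hc Ω x) fun _ => Finset.sum_le_sum fun i _ =>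
    mul_le_mul_of_nonneg_right (hcd i) (sq_nonneg _)

theorem weightedDist_smul {c : ι → ℝ} {a : ℝ} (ha : 0 ≤ a) (Ω : Matrix ι κ 𝕜) (x : ι → 𝕜) :
    weightedDist (a • c) Ω x = a * weightedDist c Ω x := by
  rw [weightedDist, weightedDist, Real.mul_iInf_of_nonneg ha]
  simp [Finset.mul_sum, mul_assoc]

/-- A common w for the total weight is a candidate for each summand. Together with homogeneity this
is the concavity in the weights behind the averaging argument. -/
theorem sum_weightedDist_le {τ : Type*} (s : Finset τ) {c : τ → ι → ℝ}
    (hc : ∀ k i, 0 ≤ c k i) (Ω : Matrix ι κ 𝕜) (x : ι → 𝕜) :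
    ∑ k ∈ s, weightedDist (c k) Ω x ≤ weightedDist (fun i => ∑ k ∈ s, c k i) Ω x := by
  refine le_ciInf fun w => ?_
  calc _ ≤ ∑ k ∈ s, ∑ i, c k i * ‖x i - (Ω *ᵥ w) i‖ ^ 2 :=
        Finset.sum_le_sum fun k _ => weightedDist_le (hc k) Ω x w
    _ = _ := by rw [Finset.sum_comm]; simp [Finset.sum_mul]

theorem weightedDist_smul_vec {c : ι → ℝ} (Ω : Matrix ι κ 𝕜) (x : ι → 𝕜) {a : 𝕜} (ha : a ≠ 0) :
    weightedDist c Ω (a • x) = ‖a‖ ^ 2 * weightedDist c Ω x := by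
  rw [weightedDist, weightedDist, Real.mul_iInf_of_nonneg (sq_nonneg _)]
  -- Substitute a • w for w in the infimum; the factor a then comes out of every residual.
  rw [← (MulAction.bijective (Units.mk0 a ha) : Function.Bijective
    (fun w : κ → 𝕜 => Units.mk0 a ha • w)).surjective.iInf_comp]
  congr! 2 with w
  rw [Finset.mul_sum]
  refine Finset.sum_congr rfl fun i _ => ?_
  rw [Units.smul_mk0, Matrix.mulVec_smul, Pi.smul_apply, Pi.smul_apply, ← smul_sub, norm_smul]
  ring

theorem sum_weight_mul_norm_sq [DecidableEq ι] (c : ι → ℝ) (y : ι → 𝕜) :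
    ∑ i, c i * ‖y i‖ ^ 2 =
      RCLike.re (star y ⬝ᵥ (Matrix.diagonal (fun i => (c i : 𝕜)) *ᵥ y)) := by
  rw [dotProduct, map_sum]
  refine Finset.sum_congr rfl fun i _ => ?_
  rw [Matrix.mulVec_diagonal, Pi.star_apply, mul_left_comm, RCLike.re_ofReal_mul,
    RCLike.star_def, RCLike.conj_mul]
  norm_cast

/-- A unitary that commutes with the diagonal weight is an isometry of the weighted seminorm. -/
theorem weightedDist_unitary_mul [DecidableEq ι] {c : ι → ℝ} {U : Matrix ι ι 𝕜}
    (hU : U ∈ Matrix.unitaryGroup ι 𝕜)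
    (hc : Matrix.diagonal (fun i => (c i : 𝕜)) * U = U * Matrix.diagonal (fun i => (c i : 𝕜)))
    (Ω : Matrix ι κ 𝕜) (x : ι → 𝕜) :
    weightedDist c (U * Ω) (U *ᵥ x) = weightedDist c Ω x := by
  rw [weightedDist, weightedDist]
  congr! 2 with w
  have h1 := sum_weight_mul_norm_sq c (U *ᵥ (x - Ω *ᵥ w))
  have h2 := sum_weight_mul_norm_sq c (x - Ω *ᵥ w)
  rw [Matrix.star_mulVec, Matrix.mulVec_mulVec, hc, ← Matrix.mulVec_mulVec, Matrix.dotProduct_mulVec,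
    Matrix.vecMul_vecMul, ← Matrix.star_eq_conjTranspose, Matrix.mem_unitaryGroup_iff'.1 hU,
    Matrix.vecMul_one, ← h2, Matrix.mulVec_sub, Matrix.mulVec_mulVec] at h1
  simpa using h1

theorem weightedDist_permMatrix [DecidableEq ι] (c : ι → ℝ) (π : Equiv.Perm ι) (Ω : Matrix ι κ 𝕜)
    (x : ι → 𝕜) :
    weightedDist (c ∘ π) Ω (x ∘ π) = weightedDist c (Ω.submatrix π.symm id) x := by
  rw [weightedDist, weightedDist]
  congr! 2 with w
  rw [← Equiv.sum_comp π fun i => c i * ‖x i - (Ω.submatrix π.symm id *ᵥ w) i‖ ^ 2]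
  simp [Matrix.mulVec, dotProduct]

/-- An infimum of continuous functions is upper semicontinuous. This gives measurability of the
error without any regularity of the pseudoinverse, which is discontinuous at rank drops. -/
theorem measurable_weightedDist {c : ι → ℝ} (hc : ∀ i, 0 ≤ c i) :
    Measurable fun p : Matrix ι κ 𝕜 × (ι → 𝕜) => weightedDist c p.1 p.2 := by
  have : BorelSpace (Matrix ι κ 𝕜) := inferInstanceAs (BorelSpace (ι → κ → 𝕜))
  have : SecondCountableTopology (Matrix ι κ 𝕜) :=
    inferInstanceAs (SecondCountableTopology (ι → κ → 𝕜))
  refine UpperSemicontinuous.measurable ?_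
  refine upperSemicontinuous_ciInf (fun p => weightedDist_bddBelow hc p.1 p.2) fun w => ?_
  refine Continuous.upperSemicontinuous ?_
  refine continuous_finsetSum _ fun i _ => continuous_const.mul ?_
  exact ((((continuous_apply i).comp continuous_snd).sub
    ((continuous_apply i).comp (continuous_fst.matrix_mulVec continuous_const))).norm).pow 2

end WeightedDist

/-! ### The Nyström error as a sum of weighted distances -/

section NystromError

variable {ι κ 𝕜 : Type*} [Fintype ι] [Fintype κ] [RCLike 𝕜]

/-- With C the square root of H, the matrix A = Ωᴴ H Ω equals (Ωᴴ C)(Ωᴴ C)ᴴ, so 1 - A A⁺ annihilates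
Ωᴴ C and with it Ωᴴ H. This makes the normal equations solvable even for singular A. -/
theorem mul_pinv_mul_conjTranspose_mul_diagonal [DecidableEq ι] [DecidableEq κ]
    {c : ι → ℝ} (hc : ∀ i, 0 ≤ c i)
    (Ω : Matrix ι κ 𝕜) (H : Matrix ι ι 𝕜) (hH : H = Matrix.diagonal fun i => (c i : 𝕜)) :
    (Ωᴴ * H * Ω) * pinv (Ωᴴ * H * Ω) * (Ωᴴ * H) = Ωᴴ * H := by
  set A := Ωᴴ * H * Ω with hA
  set X := pinv A with hX
  have hP := isMoorePenrose_pinv A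
  let C : Matrix ι ι 𝕜 := Matrix.diagonal fun i => (√(c i) : 𝕜)
  have hC : C * C = H := by
    rw [hH, Matrix.diagonal_mul_diagonal]
    congr! 2 with i
    rw [← RCLike.ofReal_mul, Real.mul_self_sqrt (hc i)]
  have hCh : Cᴴ = C := by
    rw [Matrix.diagonal_conjTranspose]
    congr! 2 with i
    simp
  have h0 : ((1 - A * X) * (Ωᴴ * C)) * ((1 - A * X) * (Ωᴴ * C))ᴴ = 0 := by
    calc _ = (1 - A * X) * (Ωᴴ * (C * C) * Ω) * (1 - A * X)ᴴ := by
          simp only [Matrix.conjTranspose_mul, hCh, Matrix.conjTranspose_conjTranspose,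
            Matrix.mul_assoc]
      _ = 0 := by
          rw [hC, ← hA, Matrix.sub_mul, Matrix.one_mul, hP.mul_mul_self, sub_self, Matrix.zero_mul]
  have h1 := Matrix.self_mul_conjTranspose_eq_zero.1 h0
  have h2 : (1 - A * X) * (Ωᴴ * H) = 0 := by
    rw [← hC, ← Matrix.mul_assoc Ωᴴ, ← Matrix.mul_assoc, h1, Matrix.zero_mul]
  rw [Matrix.sub_mul, Matrix.one_mul, sub_eq_zero] at h2
  exact h2.symm

/-- Least squares: w₀ = A⁺ Ωᴴ H x solves the normal equations, so the residual z is H-orthogonal to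
the range of Ω and Pythagoras shows that w₀ is a minimizer. -/
theorem weightedDist_eq_re [DecidableEq ι] {c : ι → ℝ} (hc : ∀ i, 0 ≤ c i)
    (Ω : Matrix ι κ 𝕜) (x : ι → 𝕜) (H : Matrix ι ι 𝕜)
    (hH : H = Matrix.diagonal fun i => (c i : 𝕜)) :
    weightedDist c Ω x =
      RCLike.re (star x ⬝ᵥ ((H - H * Ω * pinv (Ωᴴ * H * Ω) * Ωᴴ * H) *ᵥ x)) := by
  classical
  set X := pinv (Ωᴴ * H * Ω) with hX
  set w₀ : κ → 𝕜 := (X * (Ωᴴ * H)) *ᵥ x with hw₀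
  set z := x - Ω *ᵥ w₀ with hz
  have hHh : Hᴴ = H := by
    rw [hH, Matrix.diagonal_conjTranspose]
    congr! 2 with i
    simp
  have horth : (Ωᴴ * H) *ᵥ z = 0 := by
    have h := mul_pinv_mul_conjTranspose_mul_diagonal hc Ω H hH
    rw [← hX] at h
    simp only [Matrix.mul_assoc] at h
    simp only [hz, hw₀, Matrix.mulVec_sub, Matrix.mulVec_mulVec, Matrix.mul_assoc]
    rw [h, sub_self]
  have horth' (u : κ → 𝕜) : star (Ω *ᵥ u) ⬝ᵥ (H *ᵥ z) = 0 := by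
    rw [Matrix.star_mulVec, ← Matrix.dotProduct_mulVec, Matrix.mulVec_mulVec, horth,
      dotProduct_zero]
  have horth'' (u : κ → 𝕜) : star z ⬝ᵥ (H *ᵥ (Ω *ᵥ u)) = 0 := by
    have := congrArg star (horth' u)
    rw [← Matrix.star_dotProduct_star, star_zero, star_star, Matrix.star_mulVec, hHh,
      ← Matrix.dotProduct_mulVec] at this
    exact this
  have hexp (w : κ → 𝕜) : ∑ i, c i * ‖x i - (Ω *ᵥ w) i‖ ^ 2 =
      ∑ i, c i * ‖z i‖ ^ 2 + ∑ i, c i * ‖(Ω *ᵥ (w₀ - w)) i‖ ^ 2 := by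
    have : ∀ i, x i - (Ω *ᵥ w) i = (z + Ω *ᵥ (w₀ - w)) i := fun i => by
      simp [hz, Matrix.mulVec_sub]
    simp_rw [this]
    rw [sum_weight_mul_norm_sq, sum_weight_mul_norm_sq, sum_weight_mul_norm_sq, ← hH, star_add,
      Matrix.mulVec_add, add_dotProduct, dotProduct_add, dotProduct_add, horth', horth'']
    simp
  have hmin : weightedDist c Ω x = ∑ i, c i * ‖z i‖ ^ 2 := by
    refine le_antisymm ?_ (le_ciInf fun w => ?_)
    · simpa [hexp w₀] using weightedDist_le hc Ω x w₀
    · rw [hexp w]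
      exact le_add_of_nonneg_right (Finset.sum_nonneg fun i _ => mul_nonneg (hc i) (sq_nonneg _))
  rw [hmin, sum_weight_mul_norm_sq, ← hH]
  have : star z ⬝ᵥ (H *ᵥ z) = star x ⬝ᵥ (H *ᵥ z) := by
    conv_lhs => rw [hz, star_sub, sub_dotProduct, ← hz, horth', sub_zero]
  rw [this, hz, Matrix.mulVec_sub, Matrix.sub_mulVec, hw₀]
  simp only [Matrix.mulVec_mulVec, Matrix.mul_assoc]

theorem nystromError_diagonal {n ℓ : ℕ} {c : Fin n → ℝ} (hc : ∀ i, 0 ≤ c i)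
    (Ω : Matrix (Fin n) (Fin ℓ) 𝕜) :
    nystromError (Matrix.diagonal fun i => (c i : 𝕜)) Ω =
      ∑ j, weightedDist c Ω (Pi.single j 1) := by
  rw [nystromError, nystromApprox, Matrix.trace, map_sum]
  refine Finset.sum_congr rfl fun j _ => ?_
  rw [weightedDist_eq_re hc Ω _ _ rfl]
  congr 1
  rw [← Pi.single_star, star_one, single_dotProduct, one_mul, Matrix.mulVec_single_one,
    Matrix.diag_apply, Matrix.col_apply]

theorem nystromError_unitary_conj {n ℓ : ℕ} {U : Matrix (Fin n) (Fin n) 𝕜}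
    (hU : U ∈ Matrix.unitaryGroup (Fin n) 𝕜) (H : Matrix (Fin n) (Fin n) 𝕜)
    (Ω : Matrix (Fin n) (Fin ℓ) 𝕜) :
    nystromError (U * H * Uᴴ) Ω = nystromError H (Uᴴ * Ω) := by
  have h1 : (Uᴴ * Ω)ᴴ * H * (Uᴴ * Ω) = Ωᴴ * (U * H * Uᴴ) * Ω := by
    simp only [Matrix.conjTranspose_mul, Matrix.conjTranspose_conjTranspose, Matrix.mul_assoc]
  rw [nystromError, nystromError, nystromApprox, nystromApprox, h1]
  congr 1
  set X := pinv (Ωᴴ * (U * H * Uᴴ) * Ω)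
  have h2 : U * H * Uᴴ - U * H * Uᴴ * Ω * X * Ωᴴ * (U * H * Uᴴ) =
      U * ((H - H * (Uᴴ * Ω) * X * (Uᴴ * Ω)ᴴ * H) * Uᴴ) := by
    simp only [Matrix.conjTranspose_mul, Matrix.conjTranspose_conjTranspose, Matrix.mul_assoc,
      Matrix.mul_sub, Matrix.sub_mul]
  rw [h2, Matrix.trace_mul_comm, Matrix.mul_assoc, ← Matrix.star_eq_conjTranspose U,
    Matrix.mem_unitaryGroup_iff'.1 hU, Matrix.mul_one]

/-- The weighted distances of the coordinate vectors, divided by the weights, add up to the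
number of positive weights minus the number of columns. -/
theorem sum_inv_mul_weightedDist [DecidableEq ι] {c : ι → ℝ} (hc : ∀ i, 0 ≤ c i)
    (Ω : Matrix ι κ 𝕜) (hΩ : ∀ w : κ → 𝕜, (∀ i, c i ≠ 0 → (Ω *ᵥ w) i = 0) → w = 0) :
    ∑ i, (c i)⁻¹ * weightedDist c Ω (Pi.single i 1) =
      (Finset.univ.filter fun i => c i ≠ 0).card - Fintype.card κ := by
  classical
  set H : Matrix ι ι 𝕜 := Matrix.diagonal fun i => (c i : 𝕜) with hH
  set K : Matrix ι ι 𝕜 := Matrix.diagonal fun i => ((c i)⁻¹ : 𝕜) with hK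
  set A := Ωᴴ * H * Ω with hA
  -- The quadratic form of A at w is the sum of c i ‖(Ω w)_i‖², so A w = 0 forces Ω w to vanish
  -- wherever c does not.
  have hinj : Function.Injective A.mulVec := by
    refine (injective_iff_map_eq_zero A.mulVecLin).2 fun w hw => ?_
    have hw : A *ᵥ w = 0 := hw
    refine hΩ w fun i hi => ?_
    have h1 : ∑ i, c i * ‖(Ω *ᵥ w) i‖ ^ 2 = 0 := by
      rw [sum_weight_mul_norm_sq, Matrix.star_mulVec, ← Matrix.dotProduct_mulVec,
        Matrix.mulVec_mulVec, Matrix.mulVec_mulVec, ← hH, ← hA, hw]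
      simp
    have h2 := (Finset.sum_eq_zero_iff_of_nonneg
      fun i _ => mul_nonneg (hc i) (sq_nonneg _)).1 h1 i (Finset.mem_univ i)
    simpa [hi] using h2
  have hunit : IsUnit A := Matrix.mulVec_injective_iff_isUnit.1 hinj
  have hX : A * pinv A = 1 := by
    have := (isMoorePenrose_pinv A).mul_mul_self
    exact hunit.mul_right_cancel (by rw [this, one_mul])
  have hX' : pinv A * A = 1 := mul_eq_one_comm.1 hX
  -- Indices with c i = 0 cause no trouble: their inverse is 0 by convention, so K is a generalized
  -- inverse of H.
  have hHKH : H * (K * H) = H := by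
    rw [hH, hK, Matrix.diagonal_mul_diagonal, Matrix.diagonal_mul_diagonal]
    congr! 2 with i
    by_cases h : c i = 0 <;> simp [h]
  have hterm (i : ι) : (c i)⁻¹ * weightedDist c Ω (Pi.single i 1) =
      RCLike.re ((K * (H - H * Ω * pinv A * Ωᴴ * H)) i i) := by
    rw [weightedDist_eq_re hc Ω _ H rfl, ← Pi.single_star, star_one, single_dotProduct, one_mul,
      Matrix.mulVec_single_one, Matrix.col_apply, hK, Matrix.diagonal_mul,
      ← RCLike.ofReal_inv, RCLike.re_ofReal_mul]
  simp_rw [hterm]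
  rw [← map_sum]
  change RCLike.re (Matrix.trace _) = _
  have htr : (K * (H * Ω * pinv A * Ωᴴ * H)).trace = (Fintype.card κ : 𝕜) := by
    calc _ = ((K * H * Ω * pinv A * Ωᴴ) * H).trace := by simp only [Matrix.mul_assoc]
      _ = (((H * (K * H)) * Ω * pinv A) * Ωᴴ).trace := by
        rw [Matrix.trace_mul_comm]; simp only [Matrix.mul_assoc]
      _ = ((Ωᴴ * H * Ω) * pinv A).trace := by
        rw [hHKH, Matrix.trace_mul_comm]; simp only [Matrix.mul_assoc]
      _ = _ := by rw [← hA, hX, Matrix.trace_one]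
  have htr2 : (K * H).trace = ((Finset.univ.filter fun i => c i ≠ 0).card : 𝕜) := by
    rw [hH, hK, Matrix.diagonal_mul_diagonal, Matrix.trace_diagonal, Finset.card_filter]
    push_cast
    refine Finset.sum_congr rfl fun i _ => ?_
    by_cases h : c i = 0 <;> simp [h]
  rw [Matrix.mul_sub, Matrix.trace_sub, htr, htr2]
  simp

end NystromError

/-! ### Dependence of a distance on its own weight -/

section Reweighting

variable {ι κ 𝕜 : Type*} [Fintype ι] [Fintype κ] [RCLike 𝕜]

theorem weightedDist_single_le [DecidableEq ι] {c : ι → ℝ} (hc : ∀ i, 0 ≤ c i) (Ω : Matrix ι κ 𝕜)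
    (j : ι) : weightedDist c Ω (Pi.single j 1) ≤ c j := by
  refine (weightedDist_le_self hc Ω _).trans_eq ?_
  rw [Finset.sum_eq_single j]
  · simp
  · intro i _ hij
    simp [Pi.single_eq_of_ne hij]
  · simp

theorem sum_single_sub [DecidableEq ι] (c : ι → ℝ) (j : ι) (v : ι → 𝕜) :
    ∑ i, c i * ‖(Pi.single j 1 : ι → 𝕜) i - v i‖ ^ 2 =
      c j * ‖1 - v j‖ ^ 2 + ∑ i ∈ Finset.univ.erase j, c i * ‖v i‖ ^ 2 := by
  rw [← Finset.add_sum_erase _ _ (Finset.mem_univ j), Pi.single_eq_same]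
  congr 1
  refine Finset.sum_congr rfl fun i hi => ?_
  rw [Pi.single_eq_of_ne (Finset.ne_of_mem_erase hi), zero_sub, norm_neg]

/-- Scaling `w` optimally in the minimization that defines `weightedDist c Ω (Pi.single j 1)`. -/
theorem weightedDist_single_mul_le [DecidableEq ι] {c : ι → ℝ} (hc : ∀ i, 0 ≤ c i)
    (Ω : Matrix ι κ 𝕜) (j : ι) (w : κ → 𝕜) :
    c j * weightedDist c Ω (Pi.single j 1) * ‖(Ω *ᵥ w) j‖ ^ 2 ≤
      (c j - weightedDist c Ω (Pi.single j 1)) *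
        ∑ i ∈ Finset.univ.erase j, c i * ‖(Ω *ᵥ w) i‖ ^ 2 := by
  set D := weightedDist c Ω (Pi.single j 1) with hD
  set Q := ∑ i ∈ Finset.univ.erase j, c i * ‖(Ω *ᵥ w) i‖ ^ 2 with hQ
  set z := (Ω *ᵥ w) j with hz
  set a := c j with ha
  have ha0 : 0 ≤ a := hc j
  have hQ0 : 0 ≤ Q := Finset.sum_nonneg fun i _ => mul_nonneg (hc i) (sq_nonneg _)
  rcases (add_nonneg (mul_nonneg ha0 (sq_nonneg ‖z‖)) hQ0).eq_or_lt with h0 | hpos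
  · have h1 : a * ‖z‖ ^ 2 = 0 := by nlinarith [mul_nonneg ha0 (sq_nonneg ‖z‖)]
    have h2 : Q = 0 := by linarith
    rw [h2, mul_zero, mul_right_comm, h1, zero_mul]
  · set d := a * ‖z‖ ^ 2 + Q with hd
    have hz2 : (starRingEnd 𝕜 z) * z = ((‖z‖ ^ 2 : ℝ) : 𝕜) := by
      rw [RCLike.conj_mul]; norm_cast
    -- The multiplier s = a z̄ / d minimizes a |1 - s z|² + |s|² Q; the minimum is a Q / d.
    have key := weightedDist_le hc Ω (Pi.single j 1) ((((a / d : ℝ) : 𝕜) * starRingEnd 𝕜 z) • w)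
    rw [sum_single_sub, Matrix.mulVec_smul, Pi.smul_apply, ← hz, ← hD, ← ha, smul_eq_mul, mul_assoc,
      hz2] at key
    have h1 : (1 : 𝕜) - ((a / d : ℝ) : 𝕜) * ((‖z‖ ^ 2 : ℝ) : 𝕜) = ((Q / d : ℝ) : 𝕜) := by
      rw [← RCLike.ofReal_mul, ← RCLike.ofReal_one, ← RCLike.ofReal_sub]
      congr 1
      field_simp
      rw [hd]; ring
    have h2 : ∑ i ∈ Finset.univ.erase j,
        c i * ‖((((a / d : ℝ) : 𝕜) * starRingEnd 𝕜 z) • Ω *ᵥ w) i‖ ^ 2 =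
        (a / d) ^ 2 * ‖z‖ ^ 2 * Q := by
      rw [hQ, Finset.mul_sum]
      refine Finset.sum_congr rfl fun i _ => ?_
      rw [Pi.smul_apply, norm_smul, norm_mul, RCLike.norm_ofReal, RCLike.norm_conj, mul_pow,
        mul_pow, sq_abs]
      ring
    rw [h1, h2, RCLike.norm_ofReal, sq_abs] at key
    have h3 : a * (Q / d) ^ 2 + (a / d) ^ 2 * ‖z‖ ^ 2 * Q = a * Q / d := by
      field_simp
      rw [hd]; ring
    rw [h3, le_div_iff₀ hpos, hd] at key
    nlinarith

/-- One half of the reweighting identity. Exchanging the weights c j and b turns it into the other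
half, so only lower bounds on an infimum are needed. -/
theorem mul_weightedDist_single_le [DecidableEq ι] {c : ι → ℝ} (hc : ∀ i, 0 ≤ c i)
    (Ω : Matrix ι κ 𝕜) (j : ι) (hj : 0 < c j) {b : ℝ} (hb : 0 < b) :
    c j * b * weightedDist c Ω (Pi.single j 1) ≤
      weightedDist (Function.update c j b) Ω (Pi.single j 1) *
        (b * (c j - weightedDist c Ω (Pi.single j 1)) +
          c j * weightedDist c Ω (Pi.single j 1)) := by
  have hle := weightedDist_single_le hc Ω j
  have hD0 := weightedDist_nonneg hc Ω (Pi.single j 1)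
  have key := weightedDist_single_mul_le hc Ω j
  set D := weightedDist c Ω (Pi.single j 1) with hD
  set a := c j with ha
  have hden : 0 < b * (a - D) + a * D := by
    rcases hle.eq_or_lt with h | h
    · rw [h]; nlinarith
    · have := mul_pos hb (sub_pos.2 h)
      nlinarith [mul_nonneg hj.le hD0]
  rw [← div_le_iff₀ hden]
  refine le_ciInf fun w => ?_
  rw [sum_single_sub, Function.update_self]
  have hQ : ∑ i ∈ Finset.univ.erase j, Function.update c j b i * ‖(Ω *ᵥ w) i‖ ^ 2 =
      ∑ i ∈ Finset.univ.erase j, c i * ‖(Ω *ᵥ w) i‖ ^ 2 :=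
    Finset.sum_congr rfl fun i hi => by
      rw [Function.update_of_ne (Finset.ne_of_mem_erase hi)]
  rw [hQ]
  have hk := key w
  have hQ0 : 0 ≤ ∑ i ∈ Finset.univ.erase j, c i * ‖(Ω *ᵥ w) i‖ ^ 2 :=
    Finset.sum_nonneg fun i _ => mul_nonneg (hc i) (sq_nonneg _)
  set Q := ∑ i ∈ Finset.univ.erase j, c i * ‖(Ω *ᵥ w) i‖ ^ 2
  set z := (Ω *ᵥ w) j
  have hz : (1 - ‖z‖) ^ 2 ≤ ‖1 - z‖ ^ 2 := by
    rw [← sq_abs (1 - ‖z‖)]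
    have := abs_norm_sub_norm_le (1 : 𝕜) z
    rw [norm_one] at this
    gcongr
  set r := ‖z‖
  refine le_trans ?_ (add_le_add_left (mul_le_mul_of_nonneg_left hz hb.le) Q)
  rw [div_le_iff₀ hden]
  -- If D = a, then `hk` forces r = 0, and b alone already suffices as a lower bound.
  rcases hle.eq_or_lt with h | h
  · rw [h] at hk ⊢
    have hr : r ^ 2 = 0 := by
      rcases (sq_nonneg r).eq_or_lt with h' | h'
      · exact h'.symm
      · nlinarith [mul_pos (mul_pos hj hj) h']
    have hr : r = 0 := by simpa using hr
    rw [hr]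
    nlinarith [mul_nonneg hQ0 (mul_pos hj hj).le]
  · have he : 0 < a - D := sub_pos.2 h
    refine le_of_mul_le_mul_left ?_ he
    -- Since Q ≥ a D r² / (a - D), it remains to minimize b (1 - r)² + a D r² / (a - D) over r; the
    -- square vanishes at the minimizer.
    nlinarith [mul_le_mul_of_nonneg_right hk hden.le, sq_nonneg (b * (a - D) * (1 - r) - a * D * r)]

/-- How the weighted distance of a coordinate vector depends on its own weight. -/
theorem weightedDist_update [DecidableEq ι] {c : ι → ℝ} (hc : ∀ i, 0 ≤ c i)
    (Ω : Matrix ι κ 𝕜) (j : ι) (hj : 0 < c j) {b : ℝ} (hb : 0 < b) :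
    c j * b * weightedDist c Ω (Pi.single j 1) =
      weightedDist (Function.update c j b) Ω (Pi.single j 1) *
        (b * (c j - weightedDist c Ω (Pi.single j 1)) +
          c j * weightedDist c Ω (Pi.single j 1)) := by
  refine le_antisymm (mul_weightedDist_single_le hc Ω j hj hb) ?_
  have hc' : ∀ i, 0 ≤ Function.update c j b i := by
    intro i
    by_cases h : i = j
    · subst h; simpa using hb.le
    · simpa [Function.update_of_ne h] using hc i
  have := mul_weightedDist_single_le hc' Ω j (by simpa using hb) hj
  rw [Function.update_self, Function.update_idem, Function.update_eq_self] at this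
  linarith

end Reweighting

/-! ### Penalized least squares and its constrained limit -/

section PenaltyLimit

variable {𝕜 X Y E : Type*} [RCLike 𝕜] [AddCommGroup X] [Module 𝕜 X] [NormedAddCommGroup Y]
  [NormedSpace 𝕜 Y] [FiniteDimensional 𝕜 Y] [NormedAddCommGroup E] [InnerProductSpace 𝕜 E]

/-- Correct w by g (L w), with g a linear right inverse of L on its range extended to all of Y. The
constant is the operator norm of M ∘ g, finite because Y is finite dimensional. -/
theorem exists_norm_le_of_ker (L : X →ₗ[𝕜] Y) (M : X →ₗ[𝕜] E) :
    ∃ C : ℝ, ∀ w, ∃ w₀ ∈ LinearMap.ker L, ‖M w - M w₀‖ ≤ C * ‖L w‖ := by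
  obtain ⟨h, hh⟩ := L.rangeRestrict.exists_rightInverse_of_surjective L.range_rangeRestrict
  obtain ⟨g, hg⟩ := LinearMap.exists_extend h
  refine ⟨‖LinearMap.toContinuousLinearMap (M ∘ₗ g)‖, fun w => ⟨w - g (L w), ?_, ?_⟩⟩
  · have h1 : g (L w) = h (L.rangeRestrict w) := by
      rw [← hg]; rfl
    have h2 : L.rangeRestrict (h (L.rangeRestrict w)) = L.rangeRestrict w :=
      LinearMap.congr_fun hh (L.rangeRestrict w)
    have h3 : L (h (L.rangeRestrict w)) = L w := congrArg Subtype.val h2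
    rw [LinearMap.mem_ker, map_sub, h1, h3, sub_self]
  · rw [map_sub, sub_sub_cancel]
    exact (LinearMap.toContinuousLinearMap (M ∘ₗ g)).le_opNorm (L w)

/-- The minimum of `‖x - M w‖²` with a penalty on `‖L w‖²` increases to the squared distance of `x`
from the image of the kernel of `L`, as the penalty parameter grows. -/
theorem iSup_iInf_penalty (L : X →ₗ[𝕜] Y) (M : X →ₗ[𝕜] E) (x : E)
    [((LinearMap.ker L).map M).HasOrthogonalProjection] :
    ⨆ t : ℕ, ENNReal.ofReal (⨅ w, ((t : ℝ) * ‖L w‖ ^ 2 + ‖x - M w‖ ^ 2)) =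
      ENNReal.ofReal (‖x - ((LinearMap.ker L).map M).starProjection x‖ ^ 2) := by
  set V := (LinearMap.ker L).map M with hV
  set d := ‖x - V.starProjection x‖ with hd
  have hbdd (t : ℕ) : BddBelow (Set.range fun w => (t : ℝ) * ‖L w‖ ^ 2 + ‖x - M w‖ ^ 2) :=
    ⟨0, by rintro _ ⟨w, rfl⟩; positivity⟩
  refine le_antisymm (iSup_le fun t => ENNReal.ofReal_le_ofReal ?_) ?_
  · obtain ⟨w₀, hw₀, hw₁⟩ : V.starProjection x ∈ V := V.starProjection_apply_mem x
    refine (ciInf_le (hbdd t) w₀).trans_eq ?_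
    rw [LinearMap.mem_ker.1 hw₀, hw₁]
    simp [hd]
  · obtain ⟨C, hC⟩ := exists_norm_le_of_ker L M
    have hmin : ∀ w ∈ LinearMap.ker L, d ≤ ‖x - M w‖ := fun w hw => by
      rw [hd, V.starProjection_minimal]
      exact ciInf_le ⟨0, by rintro _ ⟨w, rfl⟩; positivity⟩
        (⟨M w, Submodule.mem_map_of_mem hw⟩ : V)
    -- Cauchy–Schwarz in the form (C u + v)² ≤ (1 + C²/t)(t u² + v²) with u = ‖L w‖ and v = ‖x - M
    -- w‖.
    have hlow (t : ℕ) (ht : 0 < t) :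
        d ^ 2 * (t / (t + C ^ 2)) ≤ ⨅ w, ((t : ℝ) * ‖L w‖ ^ 2 + ‖x - M w‖ ^ 2) := by
      refine le_ciInf fun w => ?_
      obtain ⟨w₀, hw₀, hw⟩ := hC w
      have h1 : d ≤ C * ‖L w‖ + ‖x - M w‖ := by
        calc d ≤ ‖x - M w₀‖ := hmin w₀ hw₀
          _ = ‖(M w - M w₀) + (x - M w)‖ := by congr 1; abel
          _ ≤ _ := (norm_add_le _ _).trans (by gcongr)
      have ht' : (0 : ℝ) < t := by exact_mod_cast ht
      have hd0 : 0 ≤ d := norm_nonneg _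
      rw [mul_div_assoc', div_le_iff₀ (by positivity)]
      have h2 : d ^ 2 ≤ (C * ‖L w‖ + ‖x - M w‖) ^ 2 := by gcongr
      nlinarith [mul_le_mul_of_nonneg_right h2 ht'.le, sq_nonneg (t * ‖L w‖ - C * ‖x - M w‖)]
    have hlim : Filter.Tendsto (fun t : ℕ => ENNReal.ofReal (d ^ 2 * (t / (t + C ^ 2))))
        Filter.atTop (nhds (ENNReal.ofReal (d ^ 2))) := by
      refine ENNReal.tendsto_ofReal ?_
      have := (tendsto_natCast_div_add_atTop (C ^ 2 : ℝ)).const_mul (d ^ 2)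
      simpa using this
    refine le_of_tendsto hlim ?_
    filter_upwards [Filter.eventually_gt_atTop 0] with t ht
    exact (ENNReal.ofReal_le_ofReal (hlow t ht)).trans
      (le_iSup (fun t : ℕ => ENNReal.ofReal (⨅ w, ((t : ℝ) * ‖L w‖ ^ 2 + ‖x - M w‖ ^ 2))) t)

end PenaltyLimit

/-! ### Householder reflections -/

section Householder

variable {ι 𝕜 : Type*} [Fintype ι] [DecidableEq ι] [RCLike 𝕜]

theorem householder_mem_unitaryGroup (u : ι → 𝕜) (hu : u ≠ 0) :
    (1 - (2 / (star u ⬝ᵥ u)) • Matrix.vecMulVec u (star u)) ∈ Matrix.unitaryGroup ι 𝕜 := by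
  have hN : star u ⬝ᵥ u ≠ 0 := fun h => hu (dotProduct_star_self_eq_zero.1 h)
  have hNs : star (star u ⬝ᵥ u) = star u ⬝ᵥ u := by
    rw [← Matrix.star_dotProduct_star, star_star]
  rw [Matrix.mem_unitaryGroup_iff', star_sub, star_smul, star_one, star_div₀, hNs,
    Matrix.star_eq_conjTranspose, Matrix.conjTranspose_vecMulVec, star_star, star_ofNat,
    Matrix.sub_mul, Matrix.one_mul, Matrix.mul_sub, Matrix.mul_one, Matrix.smul_mul,
    Matrix.mul_smul, Matrix.vecMulVec_mul_vecMulVec, smul_smul, Matrix.vecMulVec_smul, smul_smul]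
  have h : 2 / (star u ⬝ᵥ u) * (2 / (star u ⬝ᵥ u)) * (star u ⬝ᵥ u) =
      2 / (star u ⬝ᵥ u) + 2 / (star u ⬝ᵥ u) := by
    field_simp
    norm_num
  rw [h, add_smul]
  abel

/-- The unitary group acts transitively on the lines spanned by vectors supported on `T`, fixing
the other coordinates. -/
theorem exists_unitary_mulVec_eq (T : Set ι) {x y : ι → 𝕜} (hx : x ≠ 0) (hy : y ≠ 0)
    (hxT : ∀ i ∉ T, x i = 0) (hyT : ∀ i ∉ T, y i = 0) :
    ∃ U ∈ Matrix.unitaryGroup ι 𝕜, ∃ s : 𝕜, s ≠ 0 ∧ U *ᵥ x = s • y ∧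
      ∀ i j, i ∉ T ∨ j ∉ T → U i j = (1 : Matrix ι ι 𝕜) i j := by
  have hpos (v : ι → 𝕜) : star v ⬝ᵥ v = ((∑ i, ‖v i‖ ^ 2 : ℝ) : 𝕜) := by
    simp [dotProduct, RCLike.conj_mul]
  have hpos' (v : ι → 𝕜) (hv : v ≠ 0) : 0 < ∑ i, ‖v i‖ ^ 2 := by
    obtain ⟨i, hi⟩ := Function.ne_iff.1 hv
    exact Finset.sum_pos' (fun i _ => by positivity)
      ⟨i, Finset.mem_univ i, by have := norm_pos_iff.2 hi; positivity⟩
  -- The phase p makes the inner product of x and s y real, and ρ makes their norms equal. Under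
  -- these two conditions the reflection along x - s y carries x to s y.
  obtain ⟨p, hp1, hp2⟩ := RCLike.exists_norm_eq_mul_self (star x ⬝ᵥ y)
  set ρ : ℝ := √((∑ i, ‖x i‖ ^ 2) / ∑ i, ‖y i‖ ^ 2) with hρ
  have hρ0 : 0 < ρ := Real.sqrt_pos.2 (div_pos (hpos' x hx) (hpos' y hy))
  have hp0 : p ≠ 0 := fun h => by simp [h] at hp1
  set s : 𝕜 := (ρ : 𝕜) * p with hs
  have hs0 : s ≠ 0 := mul_ne_zero (RCLike.ofReal_ne_zero.2 hρ0.ne') hp0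
  have hR : star x ⬝ᵥ (s • y) = ((ρ * ‖star x ⬝ᵥ y‖ : ℝ) : 𝕜) := by
    rw [dotProduct_smul, smul_eq_mul, hs, mul_assoc, ← hp2, RCLike.ofReal_mul]
  have hR' : star (s • y) ⬝ᵥ x = ((ρ * ‖star x ⬝ᵥ y‖ : ℝ) : 𝕜) := by
    rw [Matrix.star_dotProduct, hR, RCLike.star_def, RCLike.conj_ofReal]
  have hN : star (s • y) ⬝ᵥ (s • y) = star x ⬝ᵥ x := by
    rw [hpos, hpos]
    congr 1
    have : ‖s‖ ^ 2 = (∑ i, ‖x i‖ ^ 2) / ∑ i, ‖y i‖ ^ 2 := by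
      rw [hs, norm_mul, hp1, mul_one, RCLike.norm_ofReal, sq_abs, hρ,
        Real.sq_sqrt (div_pos (hpos' x hx) (hpos' y hy)).le]
    simp_rw [Pi.smul_apply, norm_smul, mul_pow, ← Finset.mul_sum, this]
    exact div_mul_cancel₀ _ (hpos' y hy).ne'
  by_cases hu : x - s • y = 0
  · exact ⟨1, one_mem _, s, hs0, by rw [Matrix.one_mulVec, sub_eq_zero.1 hu], fun _ _ _ => rfl⟩
  refine ⟨_, householder_mem_unitaryGroup _ hu, s, hs0, ?_, ?_⟩
  · have h1 : star (x - s • y) ⬝ᵥ (x - s • y) = 2 * (star (x - s • y) ⬝ᵥ x) := by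
      rw [star_sub, sub_dotProduct, sub_dotProduct, dotProduct_sub, dotProduct_sub, hN, hR, hR']
      ring
    have h2 : star (x - s • y) ⬝ᵥ (x - s • y) ≠ 0 := by
      rw [hpos]
      exact RCLike.ofReal_ne_zero.2 (hpos' _ hu).ne'
    rw [Matrix.sub_mulVec, Matrix.one_mulVec, Matrix.smul_mulVec, Matrix.vecMulVec_mulVec]
    rw [h1] at h2 ⊢
    have h3 : star (x - s • y) ⬝ᵥ x ≠ 0 := right_ne_zero_of_mul h2
    rw [op_smul_eq_smul, smul_smul, div_mul_eq_mul_div, div_self h2, one_smul, sub_sub_cancel]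
  · intro i j hij
    rw [Matrix.sub_apply, Matrix.smul_apply, Matrix.vecMulVec_apply, sub_eq_self]
    rcases hij with h | h
    · simp [hxT i h, hyT i h]
    · simp [hxT j h, hyT j h]

end Householder

/-! ### Radial Gaussian moments -/

section GaussianMoments

variable {F : Type*} [NormedAddCommGroup F] [NormedSpace ℝ F] [FiniteDimensional ℝ F]
  [MeasurableSpace F] [BorelSpace F] (μ : Measure F) [μ.IsAddHaarMeasure]

/-- Polar coordinates reduce this to a Gamma integral. The exponents s = 0, 2, -2 are used, and
ratios of their values follow from the functional equation of Gamma. -/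
theorem lintegral_norm_rpow_mul_exp [Nontrivial F] {s : ℝ}
    (hs : 0 < (Module.finrank ℝ F : ℝ) + s) :
    ∫⁻ x, ENNReal.ofReal (‖x‖ ^ s * Real.exp (-‖x‖ ^ 2)) ∂μ =
      ENNReal.ofReal (Module.finrank ℝ F * μ.real (Metric.ball 0 1) *
        (1 / 2 * Real.Gamma ((Module.finrank ℝ F + s) / 2))) := by
  have hD : 0 < Module.finrank ℝ F := Module.finrank_pos
  have hD1 : ((Module.finrank ℝ F - 1 : ℕ) : ℝ) = Module.finrank ℝ F - 1 := by
    rw [Nat.cast_sub hD, Nat.cast_one]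
  have hcongr : ∀ y ∈ Set.Ioi (0 : ℝ), y ^ ((Module.finrank ℝ F : ℝ) - 1 + s) *
      Real.exp (-y ^ (2 : ℝ)) =
      y ^ (Module.finrank ℝ F - 1) • (y ^ s * Real.exp (-y ^ 2)) := by
    intro y hy
    rw [Real.rpow_add hy, ← hD1, Real.rpow_natCast, Real.rpow_two, smul_eq_mul, mul_assoc]
  have hint : Integrable (fun x : F => ‖x‖ ^ s * Real.exp (-‖x‖ ^ 2)) μ := by
    rw [integrable_fun_norm_addHaar μ (f := fun y : ℝ => y ^ s * Real.exp (-y ^ 2))]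
    refine IntegrableOn.congr_fun ?_ hcongr measurableSet_Ioi
    exact integrableOn_rpow_mul_exp_neg_rpow (by linarith) (by norm_num)
  rw [← ofReal_integral_eq_lintegral_ofReal hint (Filter.Eventually.of_forall fun x => by positivity),
    integral_fun_norm_addHaar μ fun y : ℝ => y ^ s * Real.exp (-y ^ 2),
    ← setIntegral_congr_fun measurableSet_Ioi hcongr,
    integral_rpow_mul_exp_neg_rpow (by norm_num) (by linarith), nsmul_eq_mul, smul_eq_mul,
    sub_add_eq_add_sub, sub_add_cancel, mul_assoc]

omit [NormedSpace ℝ F] [FiniteDimensional ℝ F] in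
theorem lintegral_exp_neg_norm_sq_ne_zero :
    ∫⁻ x, ENNReal.ofReal (Real.exp (-‖x‖ ^ 2)) ∂μ ≠ 0 := by
  rw [Ne, lintegral_eq_zero_iff (by fun_prop)]
  intro h
  have h1 : ∀ᵐ x ∂μ, False := by
    filter_upwards [h] with x hx
    simp only [Pi.zero_apply, ENNReal.ofReal_eq_zero] at hx
    exact absurd (Real.exp_pos _) hx.not_gt
  have h2 : μ = 0 := by simpa using h1
  exact NeZero.ne (μ Set.univ) (by simp [h2])

theorem lintegral_exp_neg_norm_sq_ne_top :
    ∫⁻ x, ENNReal.ofReal (Real.exp (-‖x‖ ^ 2)) ∂μ ≠ ⊤ := by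
  rcases subsingleton_or_nontrivial F with h | h
  · have : ∀ x : F, ENNReal.ofReal (Real.exp (-‖x‖ ^ 2)) = 1 := fun x => by
      rw [Subsingleton.elim x 0]; simp
    simp_rw [this, lintegral_const, one_mul]
    exact ((Set.toFinite (Set.univ : Set F)).isCompact.measure_lt_top).ne
  · have h0 := lintegral_norm_rpow_mul_exp μ (s := 0)
      (by simpa using (Module.finrank_pos : 0 < Module.finrank ℝ F))
    simp only [Real.rpow_zero, one_mul] at h0
    rw [h0]
    exact ENNReal.ofReal_ne_top

theorem lintegral_norm_sq_mul_exp :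
    ∫⁻ x, ENNReal.ofReal (‖x‖ ^ 2 * Real.exp (-‖x‖ ^ 2)) ∂μ =
      ENNReal.ofReal (Module.finrank ℝ F / 2) *
        ∫⁻ x, ENNReal.ofReal (Real.exp (-‖x‖ ^ 2)) ∂μ := by
  rcases subsingleton_or_nontrivial F with h | h
  · have : ∀ x : F, ENNReal.ofReal (‖x‖ ^ 2 * Real.exp (-‖x‖ ^ 2)) = 0 := fun x => by
      rw [Subsingleton.elim x 0]; simp
    simp [this, Module.finrank_zero_of_subsingleton]
  · have hD : (0 : ℝ) < Module.finrank ℝ F := by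
      exact_mod_cast (Module.finrank_pos : 0 < Module.finrank ℝ F)
    have h0 := lintegral_norm_rpow_mul_exp μ (s := 0) (by linarith)
    have h2 := lintegral_norm_rpow_mul_exp μ (s := 2) (by linarith)
    simp only [Real.rpow_zero, one_mul, add_zero] at h0
    simp only [Real.rpow_two] at h2
    rw [h0, h2, ← ENNReal.ofReal_mul (by positivity)]
    congr 1
    rw [add_div, div_self (two_ne_zero), Real.Gamma_add_one (by positivity)]
    ring

theorem lintegral_inv_norm_sq_mul_exp (hF : 2 < Module.finrank ℝ F) :
    ∫⁻ x, (ENNReal.ofReal (‖x‖ ^ 2))⁻¹ * ENNReal.ofReal (Real.exp (-‖x‖ ^ 2)) ∂μ =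
      ENNReal.ofReal (2 / (Module.finrank ℝ F - 2)) *
        ∫⁻ x, ENNReal.ofReal (Real.exp (-‖x‖ ^ 2)) ∂μ := by
  have : Nontrivial F := Module.nontrivial_of_finrank_pos (R := ℝ) (by omega)
  have hD : (2 : ℝ) < Module.finrank ℝ F := by exact_mod_cast hF
  have h0 := lintegral_norm_rpow_mul_exp μ (s := 0) (by linarith)
  have h2 := lintegral_norm_rpow_mul_exp μ (s := -2) (by linarith)
  simp only [Real.rpow_zero, one_mul, add_zero] at h0
  -- The two integrands differ at the origin, where the extended inverse is ⊤ but the real power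
  -- with exponent -2 is 0.
  have hae : ∀ᵐ x ∂μ, (ENNReal.ofReal (‖x‖ ^ 2))⁻¹ * ENNReal.ofReal (Real.exp (-‖x‖ ^ 2)) =
      ENNReal.ofReal (‖x‖ ^ (-2 : ℝ) * Real.exp (-‖x‖ ^ 2)) := by
    have : ∀ᵐ x ∂μ, x ≠ 0 := by
      simp [ae_iff]
    filter_upwards [this] with x hx
    have hx' : 0 < ‖x‖ := norm_pos_iff.2 hx
    rw [ENNReal.ofReal_mul (by positivity), ← ENNReal.ofReal_inv_of_pos (by positivity),
      Real.rpow_neg hx'.le, Real.rpow_two]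
  rw [lintegral_congr_ae hae, h0, h2, ← ENNReal.ofReal_mul (div_nonneg (by norm_num) (by linarith))]
  congr 1
  have h3 : Real.Gamma ((Module.finrank ℝ F : ℝ) / 2) =
      ((Module.finrank ℝ F : ℝ) + -2) / 2 * Real.Gamma (((Module.finrank ℝ F : ℝ) + -2) / 2) := by
    rw [← Real.Gamma_add_one (by linarith)]
    congr 1
    ring
  rw [h3]
  have : (Module.finrank ℝ F : ℝ) - 2 ≠ 0 := by linarith
  field_simp
  ring

end GaussianMoments

/-! ### Gaussian moments of projections onto a subspace -/

section ProjectionMoment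

variable {𝕜 E : Type*} [RCLike 𝕜] [NormedAddCommGroup E] [InnerProductSpace 𝕜 E]
  [NormedSpace ℝ E] [IsScalarTower ℝ 𝕜 E] [FiniteDimensional 𝕜 E]
  [MeasurableSpace E] [BorelSpace E] (μ : Measure E) [μ.IsAddHaarMeasure]

/-- The Gaussian expectation of the squared ratio of the components of a vector orthogonal to and
along a subspace. -/
theorem lintegral_projection_ratio (V : Submodule 𝕜 E) (hV : 2 < Module.finrank ℝ V) :
    ∫⁻ x, ENNReal.ofReal (‖x - V.starProjection x‖ ^ 2) /
        (ENNReal.ofReal (‖x‖ ^ 2) - ENNReal.ofReal (‖x - V.starProjection x‖ ^ 2)) *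
        ENNReal.ofReal (Real.exp (-‖x‖ ^ 2)) ∂μ =
      ENNReal.ofReal (Module.finrank ℝ Vᗮ / (Module.finrank ℝ V - 2)) *
        ∫⁻ x, ENNReal.ofReal (Real.exp (-‖x‖ ^ 2)) ∂μ := by
  have : FiniteDimensional ℝ 𝕜 := inferInstance
  have hfin (W : Submodule 𝕜 E) : FiniteDimensional ℝ W := FiniteDimensional.trans ℝ 𝕜 W
  have := hfin V
  have := hfin Vᗮ
  have : FiniteDimensional ℝ E := FiniteDimensional.trans ℝ 𝕜 E
  let e : (V × Vᗮ) ≃L[𝕜] E :=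
    (V.prodEquivOfIsCompl Vᗮ V.isCompl_orthogonal).toContinuousLinearEquiv
  have he (p : V × Vᗮ) : e p = p.1 + p.2 := rfl
  let μA : Measure V := Measure.addHaar
  let μB : Measure Vᗮ := Measure.addHaar
  have hmeas : MeasurableEmbedding e := e.toHomeomorph.measurableEmbedding
  -- By uniqueness of Haar measure; the scalar c multiplies both sides of the claim, so its value is
  -- irrelevant.
  obtain ⟨c, hc⟩ : ∃ c : ENNReal, μ = c • (μA.prod μB).map e :=
    ⟨_, Measure.isAddLeftInvariant_eq_smul μ _⟩
  have hproj (p : V × Vᗮ) : V.starProjection (e p) = p.1 := by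
    rw [he, map_add, V.starProjection_eq_self_iff.2 p.1.2,
      (V.starProjection_apply_eq_zero_iff).2 p.2.2, add_zero]
  have hnorm (p : V × Vᗮ) : ‖e p‖ ^ 2 = ‖p.1‖ ^ 2 + ‖p.2‖ ^ 2 := by
    have := norm_add_sq_eq_norm_sq_add_norm_sq_of_inner_eq_zero (𝕜 := 𝕜) (p.1 : E) (p.2 : E)
      (V.inner_right_of_mem_orthogonal p.1.2 p.2.2)
    rw [he, sq, this]
    simp [sq]
  have hexp (p : V × Vᗮ) : ENNReal.ofReal (Real.exp (-‖e p‖ ^ 2)) =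
      ENNReal.ofReal (Real.exp (-‖p.1‖ ^ 2)) * ENNReal.ofReal (Real.exp (-‖p.2‖ ^ 2)) := by
    rw [hnorm, neg_add, Real.exp_add, ENNReal.ofReal_mul (Real.exp_pos _).le]
  have hlhs (p : V × Vᗮ) : ENNReal.ofReal (‖e p - V.starProjection (e p)‖ ^ 2) /
        (ENNReal.ofReal (‖e p‖ ^ 2) - ENNReal.ofReal (‖e p - V.starProjection (e p)‖ ^ 2)) *
        ENNReal.ofReal (Real.exp (-‖e p‖ ^ 2)) =
      ((ENNReal.ofReal (‖p.1‖ ^ 2))⁻¹ * ENNReal.ofReal (Real.exp (-‖p.1‖ ^ 2))) *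
        ENNReal.ofReal (‖p.2‖ ^ 2 * Real.exp (-‖p.2‖ ^ 2)) := by
    rw [hexp, hnorm, hproj, he, add_sub_cancel_left,
      show ‖(p.2 : E)‖ = ‖p.2‖ from rfl,
      ← ENNReal.ofReal_sub _ (by positivity), add_sub_cancel_right,
      ENNReal.ofReal_mul (by positivity), div_eq_mul_inv]
    ring
  rw [hc, lintegral_smul_measure, lintegral_smul_measure, hmeas.lintegral_map,
    hmeas.lintegral_map]
  simp_rw [hlhs, hexp]
  rw [lintegral_prod_mul (μ := μA) (ν := μB)
      (f := fun a => (ENNReal.ofReal (‖a‖ ^ 2))⁻¹ * ENNReal.ofReal (Real.exp (-‖a‖ ^ 2)))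
      (g := fun b => ENNReal.ofReal (‖b‖ ^ 2 * Real.exp (-‖b‖ ^ 2))) (by fun_prop) (by fun_prop),
    lintegral_prod_mul (μ := μA) (ν := μB) (f := fun a => ENNReal.ofReal (Real.exp (-‖a‖ ^ 2)))
      (g := fun b => ENNReal.ofReal (Real.exp (-‖b‖ ^ 2))) (by fun_prop) (by fun_prop),
    lintegral_inv_norm_sq_mul_exp μA hV, lintegral_norm_sq_mul_exp μB]
  have hD : (0 : ℝ) < Module.finrank ℝ V - 2 := by
    rw [sub_pos]; exact_mod_cast hV
  have : ENNReal.ofReal (Module.finrank ℝ Vᗮ / (Module.finrank ℝ V - 2)) =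
      ENNReal.ofReal (2 / (Module.finrank ℝ V - 2)) * ENNReal.ofReal (Module.finrank ℝ Vᗮ / 2) := by
    rw [← ENNReal.ofReal_mul (by positivity)]
    congr 1
    field_simp
  rw [this, smul_eq_mul, smul_eq_mul]
  ring

theorem finrank_real_eq_two_sub_fieldAlpha (𝕜 : Type*) [RCLike 𝕜] :
    Module.finrank ℝ 𝕜 = 2 - fieldAlpha 𝕜 := by
  unfold fieldAlpha
  split_ifs with h
  · have := (RCLike.realLinearIsometryEquiv h).toLinearEquiv.finrank_eq
    simpa using this
  · have := (RCLike.complexLinearIsometryEquiv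
      ((RCLike.I_eq_zero_or_im_I_eq_one (K := 𝕜)).resolve_left h)).toLinearEquiv.finrank_eq
    simpa using this

theorem fieldAlpha_le_one (𝕜 : Type*) [RCLike 𝕜] : fieldAlpha 𝕜 ≤ 1 := by
  unfold fieldAlpha
  split_ifs <;> simp

/-- Real dimensions are 2 - α times dimensions over 𝕜, and 2 / (2 - α) = 1 + α for α in {0, 1}. This
is where the field constant in the theorem comes from. -/
theorem lintegral_projection_ratio' (V : Submodule 𝕜 E)
    (hV : 1 + fieldAlpha 𝕜 < Module.finrank 𝕜 V) :
    ∫⁻ x, ENNReal.ofReal (‖x - V.starProjection x‖ ^ 2) /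
        (ENNReal.ofReal (‖x‖ ^ 2) - ENNReal.ofReal (‖x - V.starProjection x‖ ^ 2)) *
        ENNReal.ofReal (Real.exp (-‖x‖ ^ 2)) ∂μ =
      ENNReal.ofReal (((Module.finrank 𝕜 E : ℝ) - Module.finrank 𝕜 V) /
        (Module.finrank 𝕜 V - 1 - fieldAlpha 𝕜)) *
        ∫⁻ x, ENNReal.ofReal (Real.exp (-‖x‖ ^ 2)) ∂μ := by
  have h1 : Module.finrank ℝ V = (2 - fieldAlpha 𝕜) * Module.finrank 𝕜 V := by
    rw [← finrank_real_eq_two_sub_fieldAlpha, Module.finrank_mul_finrank]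
  have h2 : Module.finrank ℝ Vᗮ = (2 - fieldAlpha 𝕜) * Module.finrank 𝕜 Vᗮ := by
    rw [← finrank_real_eq_two_sub_fieldAlpha, Module.finrank_mul_finrank]
  have h3 := V.finrank_add_finrank_orthogonal
  have hα := fieldAlpha_le_one 𝕜
  have hV' : (1 : ℝ) + fieldAlpha 𝕜 < Module.finrank 𝕜 V := by exact_mod_cast hV
  have h4 : 2 < Module.finrank ℝ V := by
    rw [h1]
    interval_cases fieldAlpha 𝕜 <;> omega
  rw [lintegral_projection_ratio μ V h4, h1, h2, ← h3]
  congr 2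
  generalize fieldAlpha 𝕜 = α at *
  have : α = 0 ∨ α = 1 := by omega
  rcases this with rfl | rfl
  · have : (Module.finrank 𝕜 V : ℝ) - 1 ≠ 0 := by push_cast at hV'; linarith
    have : 2 * (Module.finrank 𝕜 V : ℝ) - 2 ≠ 0 := by push_cast at hV'; linarith
    push_cast
    field_simp
    ring
  · push_cast
    ring

end ProjectionMoment

/-! ### Unitarily invariant laws and Gaussian averaging -/

section Averaging

variable {ι κ 𝕜 : Type*} [Fintype ι] [Fintype κ] [DecidableEq ι] [RCLike 𝕜]

instance matrixBorelSpace : BorelSpace (Matrix ι κ 𝕜) := inferInstanceAs (BorelSpace (ι → κ → 𝕜))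

instance matrixSecondCountableTopology : SecondCountableTopology (Matrix ι κ 𝕜) :=
  inferInstanceAs (SecondCountableTopology (ι → κ → 𝕜))

omit [DecidableEq ι] in
theorem measurable_const_mul_matrix (U : Matrix ι ι 𝕜) :
    Measurable fun M : Matrix ι κ 𝕜 => U * M :=
  (continuous_const.matrix_mul continuous_id).measurable

/-- Invariance under left multiplication by unitary matrices. -/
def IsUnitaryInvariant (ν : Measure (Matrix ι κ 𝕜)) : Prop :=
  ∀ U ∈ Matrix.unitaryGroup ι 𝕜, ν.map (fun M => U * M) = ν

theorem IsUnitaryInvariant.lintegral_mul {ν : Measure (Matrix ι κ 𝕜)} (hν : IsUnitaryInvariant ν)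
    {U : Matrix ι ι 𝕜} (hU : U ∈ Matrix.unitaryGroup ι 𝕜) {f : Matrix ι κ 𝕜 → ENNReal}
    (hf : Measurable f) : ∫⁻ M, f (U * M) ∂ν = ∫⁻ M, f M ∂ν := by
  conv_rhs => rw [← hν U hU, lintegral_map hf (measurable_const_mul_matrix U)]

/-- The action of matrices that fix all coordinates outside of `T`. -/
def FixesCompl (T : Set ι) (U : Matrix ι ι 𝕜) : Prop :=
  ∀ i j, i ∉ T ∨ j ∉ T → U i j = (1 : Matrix ι ι 𝕜) i j

/-- A unitary fixing the coordinates outside T carries the line of x to the line of y. The joint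
invariance of F moves it from x onto M, and the law of M absorbs it. -/
theorem IsUnitaryInvariant.lintegral_eq {ν : Measure (Matrix ι κ 𝕜)} (hν : IsUnitaryInvariant ν)
    {T : Set ι} {F : Matrix ι κ 𝕜 → (ι → 𝕜) → ENNReal} (hF : ∀ x, Measurable fun M => F M x)
    (hFU : ∀ U ∈ Matrix.unitaryGroup ι 𝕜, FixesCompl T U → ∀ M x, F (U * M) (U *ᵥ x) = F M x)
    (hFs : ∀ s : 𝕜, s ≠ 0 → ∀ M x, F M (s • x) = F M x) {x y : ι → 𝕜} (hx : x ≠ 0) (hy : y ≠ 0)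
    (hxT : ∀ i ∉ T, x i = 0) (hyT : ∀ i ∉ T, y i = 0) :
    ∫⁻ M, F M x ∂ν = ∫⁻ M, F M y ∂ν := by
  obtain ⟨U, hU, s, hs, hUx, hUT⟩ := exists_unitary_mulVec_eq T hx hy hxT hyT
  calc ∫⁻ M, F M x ∂ν = ∫⁻ M, F (U * M) y ∂ν := by
        refine lintegral_congr fun M => ?_
        rw [← hFU U hU hUT, hUx, hFs s hs]
    _ = ∫⁻ M, F M y ∂ν := hν.lintegral_mul hU (hF y)

/-- Extension by zero. -/
def extendZero (T : Finset ι) (x : EuclideanSpace 𝕜 T) : ι → 𝕜 :=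
  fun i => if h : i ∈ T then x ⟨i, h⟩ else 0

omit [Fintype ι] in
theorem extendZero_of_notMem {T : Finset ι} (x : EuclideanSpace 𝕜 T) {i : ι} (hi : i ∉ T) :
    extendZero T x i = 0 := dif_neg hi

omit [Fintype ι] in
theorem extendZero_coe {T : Finset ι} (x : EuclideanSpace 𝕜 T) (i : T) :
    extendZero T x i = x i := by
  simp [extendZero]

omit [Fintype ι] in
theorem extendZero_ne_zero {T : Finset ι} {x : EuclideanSpace 𝕜 T} (hx : x ≠ 0) :
    extendZero T x ≠ 0 := by
  intro h
  apply hx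
  ext i
  rw [← extendZero_coe x i, h]
  rfl

omit [Fintype ι] in
theorem continuous_extendZero (T : Finset ι) :
    Continuous (extendZero T : EuclideanSpace 𝕜 T → ι → 𝕜) := by
  refine continuous_pi fun i => ?_
  by_cases hi : i ∈ T
  · simp only [extendZero, hi, dif_pos]
    fun_prop
  · simp only [extendZero, hi, dif_neg, not_false_eq_true]
    exact continuous_const

/-- Replacing a fixed vector supported on `T` by a Gaussian one in an invariant expectation. -/
theorem IsUnitaryInvariant.lintegral_mul_gaussian {ν : Measure (Matrix ι κ 𝕜)} [SFinite ν]
    (hν : IsUnitaryInvariant ν) {T : Finset ι} {F : Matrix ι κ 𝕜 → (ι → 𝕜) → ENNReal}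
    (hF : Measurable (Function.uncurry F))
    (hFU : ∀ U ∈ Matrix.unitaryGroup ι 𝕜, FixesCompl (T : Set ι) U →
      ∀ M x, F (U * M) (U *ᵥ x) = F M x)
    (hFs : ∀ s : 𝕜, s ≠ 0 → ∀ M x, F M (s • x) = F M x) {x₀ : ι → 𝕜} (hx₀ : x₀ ≠ 0)
    (hx₀T : ∀ i ∉ T, x₀ i = 0) (μ : Measure (EuclideanSpace 𝕜 T)) [μ.IsAddHaarMeasure] :
    (∫⁻ M, F M x₀ ∂ν) * ∫⁻ x, ENNReal.ofReal (Real.exp (-‖x‖ ^ 2)) ∂μ =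
      ∫⁻ M, ∫⁻ x, F M (extendZero T x) * ENNReal.ofReal (Real.exp (-‖x‖ ^ 2)) ∂μ ∂ν := by
  obtain ⟨i, hi⟩ := Function.ne_iff.1 hx₀
  have hiT : i ∈ T := by
    by_contra h
    exact hi (hx₀T i h)
  have : Nonempty T := ⟨⟨i, hiT⟩⟩
  have hmeas : Measurable fun p : Matrix ι κ 𝕜 × EuclideanSpace 𝕜 T =>
      F p.1 (extendZero T p.2) * ENNReal.ofReal (Real.exp (-‖p.2‖ ^ 2)) := by
    refine Measurable.mul (hF.comp (measurable_fst.prodMk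
      ((continuous_extendZero T).measurable.comp measurable_snd))) (by fun_prop)
  have hFm (y : ι → 𝕜) : Measurable fun M => F M y := hF.comp measurable_prodMk_right
  -- After Tonelli, the inner expectation at almost every x (every x ≠ 0) equals the one at x₀.
  rw [lintegral_lintegral_swap hmeas.aemeasurable, ← lintegral_const_mul _ (by fun_prop)]
  have : Nontrivial (EuclideanSpace 𝕜 T) := inferInstance
  have : (nhdsWithin (0 : EuclideanSpace 𝕜 T) {0}ᶜ).NeBot := Module.punctured_nhds_neBot 𝕜 _ 0
  have hne : ∀ᵐ x ∂μ, x ≠ 0 := by simp [ae_iff]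
  refine lintegral_congr_ae ?_
  filter_upwards [hne] with x hx
  rw [lintegral_mul_const _ (hFm _), hν.lintegral_eq hFm hFU hFs hx₀ (extendZero_ne_zero hx) hx₀T
    (fun i hi => extendZero_of_notMem x hi)]

end Averaging

/-! ### General position of the rows -/

section GeneralPosition

variable {ι κ 𝕜 : Type*} [Fintype ι] [Fintype κ] [DecidableEq ι] [RCLike 𝕜]

/-- The rows of `M` in `S` together with the combination of the rows given by `x`. -/
def augmentedRows (S : Finset ι) (M : Matrix ι κ 𝕜) (x : ι → 𝕜) : Option S → κ → 𝕜 :=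
  fun o => o.elim (star x ᵥ* M) fun s => M s

omit [Fintype κ] [DecidableEq ι] in
theorem linearIndependent_augmentedRows {S : Finset ι} {M : Matrix ι κ 𝕜} {x : ι → 𝕜} :
    LinearIndependent 𝕜 (augmentedRows S M x) ↔
      LinearIndependent 𝕜 (fun s : S => M s) ∧
        star x ᵥ* M ∉ Submodule.span 𝕜 (Set.range fun s : S => M s) := by
  rw [linearIndependent_option]
  rfl

omit [DecidableEq ι] in
theorem measurableSet_linearIndependent_augmentedRows (S : Finset ι) :
    MeasurableSet {p : Matrix ι κ 𝕜 × (ι → 𝕜) | LinearIndependent 𝕜 (augmentedRows S p.1 p.2)} := by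
  have hcont : Continuous fun p : Matrix ι κ 𝕜 × (ι → 𝕜) => augmentedRows S p.1 p.2 := by
    refine continuous_pi fun o => ?_
    cases o with
    | none => exact continuous_snd.star.matrix_vecMul continuous_fst
    | some s => exact (continuous_apply (s : ι)).comp continuous_fst
  exact (isOpen_setOfPred_linearIndependent.preimage hcont).measurableSet

omit [Fintype κ] in
theorem FixesCompl.mul_apply {T : Set ι} {U : Matrix ι ι 𝕜} (hU : FixesCompl T U)
    (M : Matrix ι κ 𝕜) {i : ι} (hi : i ∉ T) : (U * M) i = M i := by
  ext k
  have : U i = (1 : Matrix ι ι 𝕜) i := funext fun j => hU i j (Or.inl hi)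
  rw [Matrix.mul_apply_eq_vecMul, this, ← Matrix.mul_apply_eq_vecMul, Matrix.one_mul]

/-- The x for which the new row falls into the span W of the old ones form a real subspace. If it
were everything, coordinate vectors would put all rows of M in W, whose dimension is below the rank
of M; so it is proper, hence Haar null. -/
theorem ae_linearIndependent_augmentedRows {S : Finset ι} {M : Matrix ι κ 𝕜}
    (hM : LinearIndependent 𝕜 (fun s : S => M s)) (hMr : M.rank = Fintype.card κ)
    (hS : S.card < Fintype.card κ) (μ : Measure (EuclideanSpace 𝕜 (Sᶜ : Finset ι)))
    [μ.IsAddHaarMeasure] :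
    ∀ᵐ x ∂μ, LinearIndependent 𝕜 (augmentedRows S M (extendZero Sᶜ x)) := by
  let W := Submodule.span 𝕜 (Set.range fun s : S => M s)
  let B : Submodule ℝ (EuclideanSpace 𝕜 (Sᶜ : Finset ι)) :=
    { carrier := {x | star (extendZero Sᶜ x) ᵥ* M ∈ W}
      zero_mem' := by
        have : extendZero Sᶜ (0 : EuclideanSpace 𝕜 (Sᶜ : Finset ι)) = 0 := by
          ext i; simp [extendZero]
        simp [this]
      add_mem' := by
        intro x y hx hy
        have : extendZero Sᶜ (x + y) = extendZero Sᶜ x + extendZero Sᶜ y := by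
          ext i; by_cases h : i ∈ Sᶜ <;> simp [extendZero, h]
        simp only [Set.mem_ofPred_eq, this, star_add, Matrix.add_vecMul]
        exact W.add_mem hx hy
      smul_mem' := by
        intro c x hx
        have : extendZero Sᶜ (c • x) = (c : 𝕜) • extendZero Sᶜ x := by
          ext i; by_cases h : i ∈ Sᶜ <;> simp [extendZero, h, RCLike.real_smul_eq_coe_mul]
        simp only [Set.mem_ofPred_eq, this, star_smul, Matrix.smul_vecMul]
        exact W.smul_mem _ hx }
  have hB : B ≠ ⊤ := by
    intro hB
    have hrows : ∀ i, M i ∈ W := by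
      intro i
      by_cases hi : i ∈ S
      · exact Submodule.subset_span ⟨⟨i, hi⟩, rfl⟩
      · have h1 : (EuclideanSpace.single ⟨i, by simpa using hi⟩ 1 :
            EuclideanSpace 𝕜 (Sᶜ : Finset ι)) ∈ B := hB ▸ Submodule.mem_top
        have h2 : extendZero Sᶜ (EuclideanSpace.single ⟨i, by simpa using hi⟩ 1 :
            EuclideanSpace 𝕜 (Sᶜ : Finset ι)) = Pi.single i 1 := by
          ext k
          by_cases hk : k ∈ Sᶜ
          · simp [extendZero, hk, Pi.single_apply]
          · have : k ≠ i := by rintro rfl; exact hk (by simpa using hi)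
            simp [extendZero, hk, this]
        have h3 : star (extendZero Sᶜ (EuclideanSpace.single ⟨i, by simpa using hi⟩ 1 :
            EuclideanSpace 𝕜 (Sᶜ : Finset ι))) ᵥ* M ∈ W := h1
        rw [h2, ← Pi.single_star, star_one, Matrix.single_one_vecMul] at h3
        exact h3
    have hle : Submodule.span 𝕜 (Set.range M.row) ≤ W := by
      rw [Submodule.span_le]
      rintro _ ⟨i, rfl⟩
      exact hrows i
    have h1 := Submodule.finrank_mono hle
    rw [← Matrix.rank_eq_finrank_span_row, hMr] at h1
    have h2 : Module.finrank 𝕜 W ≤ Fintype.card S := finrank_range_le_card _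
    rw [Fintype.card_coe] at h2
    omega
  have hBae : ∀ᵐ x ∂μ, x ∉ B := by
    rw [ae_iff]
    simpa using Measure.addHaar_submodule μ B hB
  filter_upwards [hBae] with x hx
  exact linearIndependent_augmentedRows.2 ⟨hM, hx⟩

/-- The rows of a full-rank unitarily invariant random matrix are in general position. -/
theorem IsUnitaryInvariant.ae_linearIndependent_rows {ν : Measure (Matrix ι κ 𝕜)} [SFinite ν]
    (hν : IsUnitaryInvariant ν) (hrank : ∀ᵐ M ∂ν, M.rank = Fintype.card κ) (S : Finset ι)
    (hS : S.card ≤ Fintype.card κ) : ∀ᵐ M ∂ν, LinearIndependent 𝕜 (fun s : S => M s) := by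
  classical
  induction S using Finset.induction_on with
  | empty => exact Filter.Eventually.of_forall fun M => linearIndependent_empty_type
  | insert a S ha ih =>
    rw [Finset.card_insert_of_notMem ha] at hS
    have ih := ih (by omega)
    -- F is the indicator of linear dependence. At x = e_a the augmented row is row a of M;
    -- averaging replaces e_a by a Gaussian vector supported off S, for which dependence is a null
    -- event.
    let F : Matrix ι κ 𝕜 → (ι → 𝕜) → ENNReal := fun M x =>
      Set.indicator {p : Matrix ι κ 𝕜 × (ι → 𝕜) |
        LinearIndependent 𝕜 (augmentedRows S p.1 p.2)}ᶜ 1 (M, x)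
    have hF : Measurable (Function.uncurry F) :=
      measurable_one.indicator (measurableSet_linearIndependent_augmentedRows S).compl
    have hF0 (M x) : F M x = 0 ↔ LinearIndependent 𝕜 (augmentedRows S M x) := by
      simp [F, Set.indicator_apply]
    have hFcongr {M x M' x'} (h : LinearIndependent 𝕜 (augmentedRows S M x) ↔
        LinearIndependent 𝕜 (augmentedRows S M' x')) : F M x = F M' x' := by
      simp [F, Set.indicator_apply, h]
    have hFU : ∀ U ∈ Matrix.unitaryGroup ι 𝕜, FixesCompl ((Sᶜ : Finset ι) : Set ι) U →
        ∀ M x, F (U * M) (U *ᵥ x) = F M x := by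
      intro U hU hUS M x
      refine hFcongr ?_
      have h1 : (fun s : S => (U * M) s) = fun s : S => M s :=
        funext fun s => hUS.mul_apply M (by simp)
      have h2 : star (U *ᵥ x) ᵥ* (U * M) = star x ᵥ* M := by
        rw [Matrix.star_mulVec, Matrix.vecMul_vecMul, ← Matrix.mul_assoc,
          ← Matrix.star_eq_conjTranspose, Matrix.mem_unitaryGroup_iff'.1 hU, Matrix.one_mul]
      rw [linearIndependent_augmentedRows, linearIndependent_augmentedRows, h1, h2]
    have hFs : ∀ s : 𝕜, s ≠ 0 → ∀ M x, F M (s • x) = F M x := by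
      intro s hs M x
      refine hFcongr ?_
      rw [linearIndependent_augmentedRows, linearIndependent_augmentedRows, star_smul,
        Matrix.smul_vecMul, Submodule.smul_mem_iff _ (star_ne_zero.2 hs)]
    have hsingle : ∀ i ∉ (Sᶜ : Finset ι), (Pi.single a 1 : ι → 𝕜) i = 0 := by
      intro i hi
      refine Pi.single_eq_of_ne ?_ _
      rintro rfl
      exact hi (by simpa using ha)
    have hne : (Pi.single a 1 : ι → 𝕜) ≠ 0 := by simp
    let μ : Measure (EuclideanSpace 𝕜 (Sᶜ : Finset ι)) := Measure.addHaar
    have key := hν.lintegral_mul_gaussian hF hFU hFs hne hsingle μ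
    have hzero : ∫⁻ M, ∫⁻ x, F M (extendZero Sᶜ x) *
        ENNReal.ofReal (Real.exp (-‖x‖ ^ 2)) ∂μ ∂ν = 0 := by
      rw [← lintegral_zero (μ := ν)]
      refine lintegral_congr_ae ?_
      filter_upwards [ih, hrank] with M hM hMr
      rw [← lintegral_zero (μ := μ)]
      refine lintegral_congr_ae ?_
      filter_upwards [ae_linearIndependent_augmentedRows hM hMr (by omega) μ] with x hx
      rw [(hF0 M _).2 hx, zero_mul]
    clear_value F
    have hFm (x : ι → 𝕜) : Measurable fun M => F M x := hF.comp measurable_prodMk_right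
    rw [hzero, mul_eq_zero, or_iff_left (lintegral_exp_neg_norm_sq_ne_zero μ),
      lintegral_eq_zero_iff (hFm _)] at key
    have key' : ∀ᵐ M ∂ν, LinearIndependent 𝕜 (augmentedRows S M (Pi.single a 1)) :=
      key.mono fun M hM => (hF0 M _).1 hM
    refine key'.mono fun M hM => ?_
    rw [← linearIndependent_equiv (Finset.subtypeInsertEquivOption ha).symm]
    convert hM using 1
    funext o
    cases o with
    | none =>
      simp only [augmentedRows, Option.elim, ← Pi.single_star, star_one, Matrix.single_one_vecMul]
      rfl
    | some s => rfl

/-- The rows of `M` in `S`, as a linear map. -/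
def rowMap (S : Finset ι) (M : Matrix ι κ 𝕜) : (κ → 𝕜) →ₗ[𝕜] EuclideanSpace 𝕜 S :=
  (WithLp.linearEquiv 2 𝕜 (S → 𝕜)).symm.toLinearMap ∘ₗ (M.submatrix Subtype.val id).mulVecLin

omit [Fintype ι] [DecidableEq ι] in
theorem rowMap_apply (S : Finset ι) (M : Matrix ι κ 𝕜) (w : κ → 𝕜) (i : S) :
    rowMap S M w i = (M *ᵥ w) i := rfl

omit [Fintype ι] [DecidableEq ι] in
theorem finrank_ker_rowMap {S : Finset ι} {M : Matrix ι κ 𝕜}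
    (h : LinearIndependent 𝕜 (fun s : S => M s)) :
    Module.finrank 𝕜 (LinearMap.ker (rowMap S M)) + S.card = Fintype.card κ := by
  have h1 : (M.submatrix (Subtype.val : S → ι) id).rank = Fintype.card S :=
    LinearIndependent.rank_matrix h
  have h2 := LinearMap.finrank_range_add_finrank_ker (M.submatrix (Subtype.val : S → ι) id).mulVecLin
  have h3 : LinearMap.ker (rowMap S M) =
      LinearMap.ker (M.submatrix (Subtype.val : S → ι) id).mulVecLin :=
    LinearEquiv.ker_comp _ _
  rw [h3]
  rw [Matrix.rank, Fintype.card_coe] at h1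
  rw [Module.finrank_fintype_fun_eq_card] at h2
  omega

theorem IsUnitaryInvariant.ae_injective_rows {ν : Measure (Matrix ι κ 𝕜)} [SFinite ν]
    (hν : IsUnitaryInvariant ν) (hrank : ∀ᵐ M ∂ν, M.rank = Fintype.card κ) (S : Finset ι)
    (hS : Fintype.card κ ≤ S.card) :
    ∀ᵐ M ∂ν, ∀ w : κ → 𝕜, (∀ i ∈ S, (M *ᵥ w) i = 0) → w = 0 := by
  -- As many rows as there are columns suffice: once independent, they have a common kernel of
  -- dimension 0.
  obtain ⟨S', hS', hcard⟩ := Finset.exists_subset_card_eq hS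
  filter_upwards [hν.ae_linearIndependent_rows hrank S' hcard.le] with M hM w hw
  have h := finrank_ker_rowMap hM
  have h0 : LinearMap.ker (rowMap S' M) = ⊥ := Submodule.finrank_eq_zero.1 (by omega)
  have : w ∈ LinearMap.ker (rowMap S' M) := by
    rw [LinearMap.mem_ker]
    ext i
    rw [rowMap_apply]
    exact hw i (hS' i.2)
  rwa [h0, Submodule.mem_bot] at this

end GeneralPosition

/-! ### The limiting distance and the expected residual ratio -/

section LimitDist

variable {ι κ 𝕜 : Type*} [Fintype ι] [Fintype κ] [DecidableEq ι] [RCLike 𝕜]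

/-- Weight `t` on `S`, weight `1` on `T` (outside of `S`), and weight `0` elsewhere. -/
def penaltyWeight (S T : Finset ι) (t : ℝ) : ι → ℝ :=
  fun i => if i ∈ S then t else if i ∈ T then 1 else 0

omit [Fintype ι] in
theorem penaltyWeight_nonneg (S T : Finset ι) {t : ℝ} (ht : 0 ≤ t) (i : ι) :
    0 ≤ penaltyWeight S T t i := by
  unfold penaltyWeight; split_ifs <;> simp [ht]

omit [Fintype ι] in
theorem penaltyWeight_mono (S T : Finset ι) {s t : ℝ} (hst : s ≤ t) (i : ι) :
    penaltyWeight S T s i ≤ penaltyWeight S T t i := by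
  unfold penaltyWeight; split_ifs <;> simp [hst]

/-- The limit of weighted distances as the weight on `S` goes to infinity. -/
noncomputable def limitDist (S T : Finset ι) (M : Matrix ι κ 𝕜) (x : ι → 𝕜) : ENNReal :=
  ⨆ t : ℕ, ENNReal.ofReal (weightedDist (penaltyWeight S T t) M x)

theorem measurable_limitDist (S T : Finset ι) :
    Measurable fun p : Matrix ι κ 𝕜 × (ι → 𝕜) => limitDist S T p.1 p.2 :=
  Measurable.iSup fun t => (measurable_weightedDist
    (penaltyWeight_nonneg S T t.cast_nonneg)).ennreal_ofReal

theorem weightedDist_penaltyWeight {S T : Finset ι} (hST : Disjoint S T) (t : ℝ)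
    (M : Matrix ι κ 𝕜) (x : EuclideanSpace 𝕜 T) :
    weightedDist (penaltyWeight S T t) M (extendZero T x) =
      ⨅ w, (t * ‖rowMap S M w‖ ^ 2 + ‖x - rowMap T M w‖ ^ 2) := by
  rw [weightedDist]
  congr! 2 with w
  have h1 : t * ‖rowMap S M w‖ ^ 2 = ∑ i, if i ∈ S then t * ‖(M *ᵥ w) i‖ ^ 2 else 0 := by
    rw [EuclideanSpace.norm_sq_eq, Finset.sum_ite_mem, Finset.univ_inter, Finset.mul_sum,
      ← Finset.sum_coe_sort S]
    rfl
  have h2 : ‖x - rowMap T M w‖ ^ 2 =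
      ∑ i, if i ∈ T then ‖extendZero T x i - (M *ᵥ w) i‖ ^ 2 else 0 := by
    rw [EuclideanSpace.norm_sq_eq, Finset.sum_ite_mem, Finset.univ_inter, ← Finset.sum_coe_sort T]
    refine Finset.sum_congr rfl fun i _ => ?_
    rw [extendZero_coe]
    rfl
  rw [h1, h2, ← Finset.sum_add_distrib]
  refine Finset.sum_congr rfl fun i _ => ?_
  unfold penaltyWeight
  by_cases hS : i ∈ S
  · have hT : i ∉ T := Finset.disjoint_left.1 hST hS
    simp [hS, hT, extendZero_of_notMem x hT]
  · by_cases hT : i ∈ T <;> simp [hS, hT]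

theorem limitDist_extendZero {S T : Finset ι} (hST : Disjoint S T) (M : Matrix ι κ 𝕜)
    (x : EuclideanSpace 𝕜 T) :
    limitDist S T M (extendZero T x) = ENNReal.ofReal
      (‖x - ((LinearMap.ker (rowMap S M)).map (rowMap T M)).starProjection x‖ ^ 2) := by
  rw [← iSup_iInf_penalty, limitDist]
  simp_rw [weightedDist_penaltyWeight hST]

/-- The weight is constant on T and U is the identity off T, so U commutes with the diagonal weight
for every t. -/
theorem limitDist_unitary_mul {S T : Finset ι} (hST : Disjoint S T) {U : Matrix ι ι 𝕜}
    (hU : U ∈ Matrix.unitaryGroup ι 𝕜) (hUT : FixesCompl (T : Set ι) U) (M : Matrix ι κ 𝕜)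
    (x : ι → 𝕜) : limitDist S T (U * M) (U *ᵥ x) = limitDist S T M x := by
  have h (t : ℕ) : weightedDist (penaltyWeight S T t) (U * M) (U *ᵥ x) =
      weightedDist (penaltyWeight S T t) M x := by
    refine weightedDist_unitary_mul hU ?_ M x
    ext i j
    rw [Matrix.diagonal_mul, Matrix.mul_diagonal]
    by_cases hij : i ∈ T ∧ j ∈ T
    · have hi : i ∉ S := Finset.disjoint_right.1 hST hij.1
      have hj : j ∉ S := Finset.disjoint_right.1 hST hij.2
      simp [penaltyWeight, hi, hj, hij]
    · have hij' : i ∉ (T : Set ι) ∨ j ∉ (T : Set ι) := by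
        simpa only [Finset.mem_coe] using not_and_or.1 hij
      rw [hUT i j hij', Matrix.one_apply]
      by_cases hij : i = j
      · subst hij
        rw [mul_comm]
      · simp [hij]
  simp_rw [limitDist, h]

theorem limitDist_smul (S T : Finset ι) (M : Matrix ι κ 𝕜) (x : ι → 𝕜) {s : 𝕜} (hs : s ≠ 0) :
    limitDist S T M (s • x) = ENNReal.ofReal (‖s‖ ^ 2) * limitDist S T M x := by
  simp_rw [limitDist, weightedDist_smul_vec M x hs, ENNReal.ofReal_mul (sq_nonneg ‖s‖),
    ENNReal.mul_iSup]

/-- The ratio of the squared components of `x` orthogonal to and along the subspace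
associated with `M`, `S` and `T`. -/
noncomputable def residualRatio (S T : Finset ι) (M : Matrix ι κ 𝕜) (x : ι → 𝕜) : ENNReal :=
  limitDist S T M x / (ENNReal.ofReal (∑ i, ‖x i‖ ^ 2) - limitDist S T M x)

theorem measurable_residualRatio (S T : Finset ι) :
    Measurable (Function.uncurry (residualRatio S T : Matrix ι κ 𝕜 → (ι → 𝕜) → ENNReal)) :=
  (measurable_limitDist S T).div (Measurable.sub (by fun_prop) (measurable_limitDist S T))

theorem sum_norm_sq_unitary_mulVec {U : Matrix ι ι 𝕜}
    (hU : U ∈ Matrix.unitaryGroup ι 𝕜) (x : ι → 𝕜) :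
    ∑ i, ‖(U *ᵥ x) i‖ ^ 2 = ∑ i, ‖x i‖ ^ 2 := by
  have h (y : ι → 𝕜) : ∑ i, ‖y i‖ ^ 2 = RCLike.re (star y ⬝ᵥ y) := by
    simpa using sum_weight_mul_norm_sq (fun _ => (1 : ℝ)) y
  rw [h, h, Matrix.star_mulVec, ← Matrix.dotProduct_mulVec, Matrix.mulVec_mulVec,
    ← Matrix.star_eq_conjTranspose, Matrix.mem_unitaryGroup_iff'.1 hU, Matrix.one_mulVec]

theorem residualRatio_unitary_mul {S T : Finset ι} (hST : Disjoint S T) {U : Matrix ι ι 𝕜}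
    (hU : U ∈ Matrix.unitaryGroup ι 𝕜) (hUT : FixesCompl (T : Set ι) U) (M : Matrix ι κ 𝕜)
    (x : ι → 𝕜) : residualRatio S T (U * M) (U *ᵥ x) = residualRatio S T M x := by
  rw [residualRatio, residualRatio, limitDist_unitary_mul hST hU hUT, sum_norm_sq_unitary_mulVec hU]

theorem residualRatio_smul (S T : Finset ι) (M : Matrix ι κ 𝕜) (x : ι → 𝕜) {s : 𝕜} (hs : s ≠ 0) :
    residualRatio S T M (s • x) = residualRatio S T M x := by
  have h1 : ∑ i, ‖(s • x) i‖ ^ 2 = ‖s‖ ^ 2 * ∑ i, ‖x i‖ ^ 2 := by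
    simp_rw [Pi.smul_apply, norm_smul, mul_pow, Finset.mul_sum]
  have h2 : ENNReal.ofReal (‖s‖ ^ 2) ≠ 0 := by simpa using hs
  rw [residualRatio, residualRatio, limitDist_smul S T M x hs, h1,
    ENNReal.ofReal_mul (sq_nonneg _), ← ENNReal.mul_sub fun _ _ => ENNReal.ofReal_ne_top,
    ENNReal.mul_div_mul_left _ _ h2 ENNReal.ofReal_ne_top]

theorem sum_norm_sq_extendZero (T : Finset ι) (x : EuclideanSpace 𝕜 T) :
    ∑ i, ‖extendZero T x i‖ ^ 2 = ‖x‖ ^ 2 := by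
  rw [EuclideanSpace.norm_sq_eq, ← Finset.sum_subset (Finset.subset_univ T), ← Finset.sum_coe_sort T]
  · exact Finset.sum_congr rfl fun i _ => by rw [extendZero_coe]
  · intro i _ hi
    simp [extendZero_of_notMem x hi]

/-- The expected residual ratio of a coordinate vector. -/
theorem IsUnitaryInvariant.lintegral_residualRatio {ν : Measure (Matrix ι κ 𝕜)}
    [IsProbabilityMeasure ν] (hν : IsUnitaryInvariant ν)
    (hrank : ∀ᵐ M ∂ν, M.rank = Fintype.card κ) {S T : Finset ι} (hST : Disjoint S T)
    (hle : Fintype.card κ ≤ S.card + T.card) (hα : S.card + 1 + fieldAlpha 𝕜 < Fintype.card κ)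
    {j : ι} (hj : j ∈ T) :
    ∫⁻ M, residualRatio S T M (Pi.single j 1) ∂ν =
      ENNReal.ofReal (((S.card : ℝ) + T.card - Fintype.card κ) /
        ((Fintype.card κ : ℝ) - S.card - 1 - fieldAlpha 𝕜)) := by
  have hsingle : ∀ i ∉ T, (Pi.single j 1 : ι → 𝕜) i = 0 := by
    intro i hi
    refine Pi.single_eq_of_ne ?_ _
    rintro rfl
    exact hi hj
  let μ : Measure (EuclideanSpace 𝕜 T) := Measure.addHaar
  have key := hν.lintegral_mul_gaussian (measurable_residualRatio S T)
    (fun U hU hUT M x => residualRatio_unitary_mul hST hU hUT M x)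
    (fun s hs M x => residualRatio_smul S T M x hs)
    (by simp : (Pi.single j 1 : ι → 𝕜) ≠ 0) hsingle μ
  have hae : ∀ᵐ M ∂ν, ∫⁻ x, residualRatio S T M (extendZero T x) *
      ENNReal.ofReal (Real.exp (-‖x‖ ^ 2)) ∂μ =
      ENNReal.ofReal (((S.card : ℝ) + T.card - Fintype.card κ) /
        ((Fintype.card κ : ℝ) - S.card - 1 - fieldAlpha 𝕜)) *
      ∫⁻ x, ENNReal.ofReal (Real.exp (-‖x‖ ^ 2)) ∂μ := by
    filter_upwards [hν.ae_linearIndependent_rows hrank S (by omega),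
      hν.ae_injective_rows hrank (S ∪ T) (by rwa [Finset.card_union_of_disjoint hST])] with M hM hinj
    set V := (LinearMap.ker (rowMap S M)).map (rowMap T M) with hV
    have hdim : Module.finrank 𝕜 V + S.card = Fintype.card κ := by
      -- A vector in the kernel of both row maps is killed by all rows in S ∪ T, hence is 0. So V
      -- has the dimension of the kernel, ℓ - |S|.
      have hinjOn : LinearMap.ker ((rowMap T M).domRestrict (LinearMap.ker (rowMap S M))) = ⊥ := by
        rw [LinearMap.ker_eq_bot']
        intro w hw
        refine Subtype.ext (hinj w fun i hi => ?_)
        rcases Finset.mem_union.1 hi with hi | hi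
        · have := congrArg (fun v : EuclideanSpace 𝕜 S => v ⟨i, hi⟩) (LinearMap.mem_ker.1 w.2)
          exact this
        · have := congrArg (fun v : EuclideanSpace 𝕜 T => v ⟨i, hi⟩) hw
          exact this
      have := LinearMap.finrank_range_of_inj (LinearMap.ker_eq_bot.1 hinjOn)
      rw [hV, ← LinearMap.range_domRestrict, this]
      exact finrank_ker_rowMap hM
    have hratio := lintegral_projection_ratio' μ V (by omega)
    have hd : (Module.finrank 𝕜 V : ℝ) = Fintype.card κ - S.card := by
      rw [← hdim]; push_cast; ring
    rw [finrank_euclideanSpace, Fintype.card_coe, hd] at hratio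
    simp_rw [residualRatio, limitDist_extendZero hST, sum_norm_sq_extendZero]
    rw [hratio]
    congr 3
    ring
  rw [lintegral_congr_ae hae, lintegral_const, measure_univ, mul_one] at key
  exact (ENNReal.mul_left_inj (lintegral_exp_neg_norm_sq_ne_zero μ)
    (lintegral_exp_neg_norm_sq_ne_top μ)).1 key

end LimitDist

/-! ### The error for a spiked spectrum -/

section Spiked

variable {ι κ 𝕜 : Type*} [Fintype ι] [Fintype κ] [DecidableEq ι] [RCLike 𝕜]

omit [Fintype ι] in
theorem update_penaltyWeight {Q T : Finset ι} {j : ι} (hj : j ∈ Q) (t : ℝ) :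
    Function.update (penaltyWeight Q T t) j 1 = penaltyWeight (Q.erase j) (insert j T) t := by
  ext i
  by_cases hij : i = j
  · subst hij
    simp [penaltyWeight]
  · simp [penaltyWeight, hij]

theorem mul_weightedDist_penaltyWeight {Q T : Finset ι} {j : ι} (hj : j ∈ Q) {t : ℝ} (ht : 0 < t)
    (M : Matrix ι κ 𝕜) :
    t * weightedDist (penaltyWeight Q T t) M (Pi.single j 1) =
      weightedDist (penaltyWeight (Q.erase j) (insert j T) t) M (Pi.single j 1) *
        (t - weightedDist (penaltyWeight Q T t) M (Pi.single j 1) +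
          t * weightedDist (penaltyWeight Q T t) M (Pi.single j 1)) := by
  have hjt : penaltyWeight Q T t j = t := by simp [penaltyWeight, hj]
  have := weightedDist_update (penaltyWeight_nonneg Q T ht.le) M j (by rwa [hjt]) one_pos
  rwa [update_penaltyWeight hj, hjt, mul_one, one_mul] at this

theorem weightedDist_penaltyWeight_erase_le_one {Q T : Finset ι} {j : ι}
    {t : ℝ} (ht : 0 ≤ t) (M : Matrix ι κ 𝕜) :
    weightedDist (penaltyWeight (Q.erase j) (insert j T) t) M (Pi.single j 1) ≤ 1 := by
  refine (weightedDist_single_le (penaltyWeight_nonneg _ _ ht) M j).trans_eq ?_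
  simp [penaltyWeight]

theorem sum_norm_sq_single (j : ι) : ∑ i, ‖(Pi.single j 1 : ι → 𝕜) i‖ ^ 2 = 1 := by
  rw [Finset.sum_eq_single j (fun i _ hi => by simp [Pi.single_eq_of_ne hi]) (by simp)]
  simp

theorem residualRatio_single (S T : Finset ι) (M : Matrix ι κ 𝕜) (j : ι) :
    residualRatio S T M (Pi.single j 1) =
      limitDist S T M (Pi.single j 1) / (1 - limitDist S T M (Pi.single j 1)) := by
  rw [residualRatio, sum_norm_sq_single, ENNReal.ofReal_one]

/-- The reweighting identity reads D = δ / (1 - δ + δ/t), which is at most δ / (1 - δ), and δ is at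
most its limit. When δ = 1 the bound is ⊤. -/
theorem ofReal_weightedDist_le_residualRatio {Q T : Finset ι} {j : ι} (hj : j ∈ Q) {t : ℕ}
    (ht : 0 < t) (M : Matrix ι κ 𝕜) :
    ENNReal.ofReal (weightedDist (penaltyWeight Q T t) M (Pi.single j 1)) ≤
      residualRatio (Q.erase j) (insert j T) M (Pi.single j 1) := by
  have ht' : (0 : ℝ) < t := by exact_mod_cast ht
  have key := mul_weightedDist_penaltyWeight (T := T) hj ht' M
  have hD := weightedDist_nonneg (penaltyWeight_nonneg Q T ht'.le) M (Pi.single j 1)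
  have hδ := weightedDist_nonneg (penaltyWeight_nonneg (Q.erase j) (insert j T) ht'.le) M
    (Pi.single j 1)
  have hδ1 := weightedDist_penaltyWeight_erase_le_one (Q := Q) (T := T) (j := j) ht'.le M
  have hle : ENNReal.ofReal
      (weightedDist (penaltyWeight (Q.erase j) (insert j T) t) M (Pi.single j 1)) ≤
      limitDist (Q.erase j) (insert j T) M (Pi.single j 1) :=
    le_iSup (fun t : ℕ => ENNReal.ofReal
      (weightedDist (penaltyWeight (Q.erase j) (insert j T) t) M (Pi.single j 1))) t
  rw [residualRatio_single]
  refine le_trans ?_ (ENNReal.div_le_div hle (tsub_le_tsub_left hle 1))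
  set D := weightedDist (penaltyWeight Q T t) M (Pi.single j 1)
  set δ := weightedDist (penaltyWeight (Q.erase j) (insert j T) t) M (Pi.single j 1)
  have h1 : (1 : ENNReal) - ENNReal.ofReal δ = ENNReal.ofReal (1 - δ) := by
    rw [ENNReal.ofReal_sub _ hδ, ENNReal.ofReal_one]
  rw [h1]
  rcases hδ1.eq_or_lt with h | h
  · rw [h]
    simp
  · rw [← ENNReal.ofReal_div_of_pos (by linarith)]
    refine ENNReal.ofReal_le_ofReal ?_
    rw [le_div_iff₀ (by linarith)]
    refine le_of_mul_le_mul_left ?_ ht'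
    nlinarith [mul_nonneg hδ hD]

theorem tendsto_weightedDist_residualRatio {Q T : Finset ι} {j : ι} (hj : j ∈ Q)
    (M : Matrix ι κ 𝕜) :
    Filter.Tendsto
      (fun t : ℕ => ENNReal.ofReal (weightedDist (penaltyWeight Q T t) M (Pi.single j 1)))
      Filter.atTop (nhds (residualRatio (Q.erase j) (insert j T) M (Pi.single j 1))) := by
  set δ : ℕ → ℝ := fun t =>
    weightedDist (penaltyWeight (Q.erase j) (insert j T) t) M (Pi.single j 1) with hδ
  set L := limitDist (Q.erase j) (insert j T) M (Pi.single j 1) with hL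
  have hδ0 (t) : 0 ≤ δ t :=
    weightedDist_nonneg (penaltyWeight_nonneg _ _ t.cast_nonneg) M (Pi.single j 1)
  have hδ1 (t) : δ t ≤ 1 := weightedDist_penaltyWeight_erase_le_one t.cast_nonneg M
  have hmono : Monotone δ := fun s t hst =>
    weightedDist_mono (penaltyWeight_nonneg _ _ s.cast_nonneg)
      (penaltyWeight_mono _ _ (by exact_mod_cast hst)) M _
  have hL1 : L ≤ 1 := iSup_le fun t => ENNReal.ofReal_le_one.2 (hδ1 t)
  have hLtop : L ≠ ⊤ := ne_top_of_le_ne_top ENNReal.one_ne_top hL1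
  have hlim : Filter.Tendsto (fun t => ENNReal.ofReal (δ t)) Filter.atTop (nhds L) :=
    tendsto_atTop_iSup fun s t hst => ENNReal.ofReal_le_ofReal (hmono hst)
  have hlim' : Filter.Tendsto δ Filter.atTop (nhds L.toReal) := by
    have := (ENNReal.tendsto_toReal hLtop).comp hlim
    refine this.congr fun t => ?_
    exact ENNReal.toReal_ofReal (hδ0 t)
  have hden : Filter.Tendsto (fun t : ℕ => ENNReal.ofReal (1 - δ t + δ t / t)) Filter.atTop
      (nhds (1 - L)) := by
    have h1 : (1 : ENNReal) - L = ENNReal.ofReal (1 - L.toReal + 0) := by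
      rw [add_zero, ENNReal.ofReal_sub _ ENNReal.toReal_nonneg, ENNReal.ofReal_one,
        ENNReal.ofReal_toReal hLtop]
    rw [h1]
    exact ENNReal.tendsto_ofReal ((hlim'.const_sub 1).add
      (hlim'.div_atTop tendsto_natCast_atTop_atTop))
  rw [residualRatio_single, ← hL]
  -- The form 0/0 cannot occur: if L = 0, the denominator tends to 1. If L = 1 the limit is ⊤.
  have hdiv := ENNReal.Tendsto.div hlim (by
    by_cases h : L = 0
    · right; simp [h]
    · exact Or.inl h) hden (Or.inr hLtop)
  refine hdiv.congr' ?_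
  filter_upwards [Filter.eventually_gt_atTop 0] with t ht
  have ht' : (0 : ℝ) < t := by exact_mod_cast ht
  have hpos : 0 < 1 - δ t + δ t / t := by
    rcases (hδ1 t).eq_or_lt with h | h
    · rw [h]; positivity
    · have : 0 ≤ δ t / t := div_nonneg (hδ0 t) ht'.le
      linarith
  rw [← ENNReal.ofReal_div_of_pos hpos]
  congr 1
  rw [div_eq_iff hpos.ne']
  have key := mul_weightedDist_penaltyWeight (T := T) hj ht' M
  rw [← mul_right_inj' ht'.ne', ← sub_eq_zero]
  rw [← sub_eq_zero] at key
  rw [← neg_eq_zero, ← key]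
  simp only [hδ]
  field_simp
  ring

/-- Add (1 - 1/t) D_j over Q to the identity for the sum of D_j / c_j; off Q ∪ T both the weight and
the distance vanish. Only the distances of the spikes then remain random. -/
theorem sum_weightedDist_penaltyWeight {Q T : Finset ι} (hQT : Disjoint Q T) {t : ℝ} (ht : 0 < t)
    {M : Matrix ι κ 𝕜} (hM : ∀ w : κ → 𝕜, (∀ i ∈ Q ∪ T, (M *ᵥ w) i = 0) → w = 0) :
    ∑ j, weightedDist (penaltyWeight Q T t) M (Pi.single j 1) =
      (Q.card + T.card - Fintype.card κ) +
        (1 - 1 / t) * ∑ j ∈ Q, weightedDist (penaltyWeight Q T t) M (Pi.single j 1) := by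
  have hc := penaltyWeight_nonneg Q T ht.le
  have hsupp : ∀ i, penaltyWeight Q T t i ≠ 0 ↔ i ∈ Q ∪ T := by
    intro i
    unfold penaltyWeight
    by_cases hQ : i ∈ Q
    · simp [hQ, ht.ne']
    · by_cases hT : i ∈ T <;> simp [hQ, hT]
  have h1 := sum_inv_mul_weightedDist hc M fun w hw => hM w fun i hi => hw i ((hsupp i).2 hi)
  have h2 : (Finset.univ.filter fun i => penaltyWeight Q T t i ≠ 0) = Q ∪ T := by
    ext i; simp [hsupp]
  have h3 : ∑ j ∈ Q, (1 - 1 / t) * weightedDist (penaltyWeight Q T t) M (Pi.single j 1) =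
      ∑ j, if j ∈ Q then (1 - 1 / t) * weightedDist (penaltyWeight Q T t) M (Pi.single j 1)
        else 0 := by
    rw [Finset.sum_ite_mem, Finset.univ_inter]
  rw [h2, Finset.card_union_of_disjoint hQT, Nat.cast_add] at h1
  rw [← h1, Finset.mul_sum, h3, ← Finset.sum_add_distrib]
  refine Finset.sum_congr rfl fun i _ => ?_
  have hle := weightedDist_single_le hc M i
  have hge := weightedDist_nonneg hc M (Pi.single i 1)
  by_cases hQ : i ∈ Q
  · have : penaltyWeight Q T t i = t := by simp [penaltyWeight, hQ]
    rw [this, if_pos hQ]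
    field_simp
    ring
  · by_cases hT : i ∈ T
    · have : penaltyWeight Q T t i = 1 := by simp [penaltyWeight, hQ, hT]
      rw [this, if_neg hQ]
      ring
    · have : penaltyWeight Q T t i = 0 := by simp [penaltyWeight, hQ, hT]
      rw [this] at hle
      rw [le_antisymm hle hge, if_neg hQ]
      ring

omit [DecidableEq ι] in
theorem measurable_weightedDist_left {c : ι → ℝ} (hc : ∀ i, 0 ≤ c i) (x : ι → 𝕜) :
    Measurable fun M : Matrix ι κ 𝕜 => weightedDist c M x :=
  Measurable.comp (g := fun p : Matrix ι κ 𝕜 × (ι → 𝕜) => weightedDist c p.1 p.2)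
    (f := fun M => (M, x)) (measurable_weightedDist hc) measurable_prodMk_right

theorem measurable_residualRatio_left (S T : Finset ι) (x : ι → 𝕜) :
    Measurable fun M : Matrix ι κ 𝕜 => residualRatio S T M x :=
  Measurable.comp (g := Function.uncurry (residualRatio S T : Matrix ι κ 𝕜 → (ι → 𝕜) → ENNReal))
    (f := fun M => (M, x)) (measurable_residualRatio S T) measurable_prodMk_right

/-- Moving j from Q to T lowers the number of constraints by one, which cancels the extra 1 in the
condition and in the denominator for the residual ratio. -/
theorem IsUnitaryInvariant.lintegral_residualRatio_erase {ν : Measure (Matrix ι κ 𝕜)}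
    [IsProbabilityMeasure ν] (hν : IsUnitaryInvariant ν)
    (hrank : ∀ᵐ M ∂ν, M.rank = Fintype.card κ) {Q T : Finset ι} (hQT : Disjoint Q T)
    (hα : Q.card + fieldAlpha 𝕜 < Fintype.card κ) (hle : Fintype.card κ ≤ Q.card + T.card)
    {j : ι} (hj : j ∈ Q) :
    ∫⁻ M, residualRatio (Q.erase j) (insert j T) M (Pi.single j 1) ∂ν =
      ENNReal.ofReal (((Q.card : ℝ) + T.card - Fintype.card κ) /
        ((Fintype.card κ : ℝ) - Q.card - fieldAlpha 𝕜)) := by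
  have hjT : j ∉ T := Finset.disjoint_left.1 hQT hj
  have hQ : (Q.erase j).card + 1 = Q.card := Finset.card_erase_add_one hj
  have hT : (insert j T).card = T.card + 1 := Finset.card_insert_of_notMem hjT
  have hdisj : Disjoint (Q.erase j) (insert j T) := by
    rw [Finset.disjoint_insert_right]
    exact ⟨Finset.notMem_erase j Q, hQT.mono_left (Finset.erase_subset j Q)⟩
  rw [hν.lintegral_residualRatio hrank hdisj (by omega) (by omega) (Finset.mem_insert_self j T),
    hT, ← hQ]
  congr 2 <;> push_cast <;> ring

theorem IsUnitaryInvariant.lintegral_add_sum_residualRatio {ν : Measure (Matrix ι κ 𝕜)}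
    [IsProbabilityMeasure ν] (hν : IsUnitaryInvariant ν)
    (hrank : ∀ᵐ M ∂ν, M.rank = Fintype.card κ) {Q T : Finset ι} (hQT : Disjoint Q T)
    (hα : Q.card + fieldAlpha 𝕜 < Fintype.card κ) (hle : Fintype.card κ ≤ Q.card + T.card) :
    ∫⁻ M, (ENNReal.ofReal ((Q.card : ℝ) + T.card - Fintype.card κ) +
        ∑ j ∈ Q, residualRatio (Q.erase j) (insert j T) M (Pi.single j 1)) ∂ν =
      ENNReal.ofReal (((Q.card : ℝ) + T.card - Fintype.card κ) *
        (1 + Q.card / ((Fintype.card κ : ℝ) - Q.card - fieldAlpha 𝕜))) := by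
  have hpos : (0 : ℝ) < (Fintype.card κ : ℝ) - Q.card - fieldAlpha 𝕜 := by
    have : (Q.card : ℝ) + fieldAlpha 𝕜 < Fintype.card κ := by exact_mod_cast hα
    linarith
  have hnn : (0 : ℝ) ≤ (Q.card : ℝ) + T.card - Fintype.card κ := by
    have : (Fintype.card κ : ℝ) ≤ Q.card + T.card := by exact_mod_cast hle
    linarith
  rw [lintegral_add_left measurable_const, lintegral_const, measure_univ, mul_one,
    lintegral_finsetSum _ fun j _ => measurable_residualRatio_left _ _ _,
    Finset.sum_congr rfl fun j hj => hν.lintegral_residualRatio_erase hrank hQT hα hle hj,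
    Finset.sum_const, nsmul_eq_mul, ← ENNReal.ofReal_natCast,
    ← ENNReal.ofReal_mul (by positivity), ← ENNReal.ofReal_add hnn (by positivity)]
  congr 1
  ring

/-- The expected error for a spiked spectrum is bounded by its limit. -/
theorem IsUnitaryInvariant.lintegral_sum_weightedDist_le {ν : Measure (Matrix ι κ 𝕜)}
    [IsProbabilityMeasure ν] (hν : IsUnitaryInvariant ν)
    (hrank : ∀ᵐ M ∂ν, M.rank = Fintype.card κ) {Q T : Finset ι} (hQT : Disjoint Q T)
    (hα : Q.card + fieldAlpha 𝕜 < Fintype.card κ) (hle : Fintype.card κ ≤ Q.card + T.card)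
    {t : ℕ} (ht : 0 < t) :
    ∫⁻ M, ENNReal.ofReal (∑ j, weightedDist (penaltyWeight Q T t) M (Pi.single j 1)) ∂ν ≤
      ENNReal.ofReal (((Q.card : ℝ) + T.card - Fintype.card κ) *
        (1 + Q.card / ((Fintype.card κ : ℝ) - Q.card - fieldAlpha 𝕜))) := by
  have ht' : (0 : ℝ) < t := by exact_mod_cast ht
  have hbound : ∀ᵐ M ∂ν,
      ENNReal.ofReal (∑ j, weightedDist (penaltyWeight Q T t) M (Pi.single j 1)) ≤
      ENNReal.ofReal ((Q.card : ℝ) + T.card - Fintype.card κ) +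
        ∑ j ∈ Q, residualRatio (Q.erase j) (insert j T) M (Pi.single j 1) := by
    filter_upwards [hν.ae_injective_rows hrank (Q ∪ T)
      (by rwa [Finset.card_union_of_disjoint hQT])] with M hM
    have hD (j) := weightedDist_nonneg (penaltyWeight_nonneg Q T ht'.le) M (Pi.single j 1)
    rw [sum_weightedDist_penaltyWeight hQT ht' hM]
    refine ENNReal.ofReal_add_le.trans (add_le_add_right ?_ _)
    have hsum := Finset.sum_nonneg fun j (_ : j ∈ Q) => hD j
    calc _ ≤ ENNReal.ofReal
          (∑ j ∈ Q, weightedDist (penaltyWeight Q T t) M (Pi.single j 1)) := by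
          refine ENNReal.ofReal_le_ofReal (mul_le_of_le_one_left hsum ?_)
          have : 0 < 1 / (t : ℝ) := by positivity
          linarith
      _ ≤ _ := by
          rw [ENNReal.ofReal_sum_of_nonneg fun j _ => hD j]
          exact Finset.sum_le_sum fun j hj => ofReal_weightedDist_le_residualRatio hj ht M
  exact (lintegral_mono_ae hbound).trans_eq
    (hν.lintegral_add_sum_residualRatio hrank hQT hα hle)

/-- The expected error for a spiked spectrum converges to its upper bound. -/
theorem IsUnitaryInvariant.tendsto_lintegral_sum_weightedDist {ν : Measure (Matrix ι κ 𝕜)}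
    [IsProbabilityMeasure ν] (hν : IsUnitaryInvariant ν)
    (hrank : ∀ᵐ M ∂ν, M.rank = Fintype.card κ) {Q T : Finset ι} (hQT : Disjoint Q T)
    (hα : Q.card + fieldAlpha 𝕜 < Fintype.card κ) (hle : Fintype.card κ ≤ Q.card + T.card) :
    Filter.Tendsto (fun t : ℕ => ∫⁻ M, ENNReal.ofReal
        (∑ j, weightedDist (penaltyWeight Q T t) M (Pi.single j 1)) ∂ν) Filter.atTop
      (nhds (ENNReal.ofReal (((Q.card : ℝ) + T.card - Fintype.card κ) *
        (1 + Q.card / ((Fintype.card κ : ℝ) - Q.card - fieldAlpha 𝕜))))) := by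
  have hnn : (0 : ℝ) ≤ (Q.card : ℝ) + T.card - Fintype.card κ := by
    have : (Fintype.card κ : ℝ) ≤ Q.card + T.card := by exact_mod_cast hle
    linarith
  rw [← hν.lintegral_add_sum_residualRatio hrank hQT hα hle]
  refine lintegral_tendsto_of_tendsto_of_monotone (fun t => ?_) ?_ ?_
  · exact (Measurable.ennreal_ofReal (Finset.measurable_sum _ fun j _ =>
      measurable_weightedDist_left (penaltyWeight_nonneg Q T t.cast_nonneg) _)).aemeasurable
  · refine Filter.Eventually.of_forall fun M s t hst => ENNReal.ofReal_le_ofReal ?_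
    exact Finset.sum_le_sum fun j _ => weightedDist_mono (penaltyWeight_nonneg _ _ s.cast_nonneg)
      (penaltyWeight_mono _ _ (by exact_mod_cast hst)) M _
  · filter_upwards [hν.ae_injective_rows hrank (Q ∪ T)
      (by rwa [Finset.card_union_of_disjoint hQT])] with M hM
    have h1 : Filter.Tendsto (fun t : ℕ => ENNReal.ofReal (1 - 1 / (t : ℝ))) Filter.atTop
        (nhds 1) := by
      have := ENNReal.tendsto_ofReal ((tendsto_one_div_atTop_nhds_zero_nat (𝕜 := ℝ)).const_sub 1)
      simpa using this
    have h2 := tendsto_finsetSum Q fun j hj =>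
      tendsto_weightedDist_residualRatio (T := T) hj M
    have h3 := (ENNReal.Tendsto.mul h1 (Or.inl one_ne_zero) h2 (Or.inr ENNReal.one_ne_top)).const_add
      (ENNReal.ofReal ((Q.card : ℝ) + T.card - Fintype.card κ))
    rw [one_mul] at h3
    refine h3.congr' ?_
    filter_upwards [Filter.eventually_gt_atTop 0] with t ht
    have ht' : (1 : ℝ) ≤ t := by exact_mod_cast ht
    have ht0 : 0 < (t : ℝ) := by linarith
    have hD (j) := weightedDist_nonneg (penaltyWeight_nonneg Q T ht0.le) M (Pi.single j 1)
    have ht1 : 0 ≤ 1 - 1 / (t : ℝ) := by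
      rw [sub_nonneg, div_le_one ht0]; exact ht'
    rw [sum_weightedDist_penaltyWeight hQT ht0 hM, ENNReal.ofReal_add hnn
      (mul_nonneg ht1 (Finset.sum_nonneg fun j _ => hD j)), ENNReal.ofReal_mul ht1,
      ENNReal.ofReal_sum_of_nonneg fun j _ => hD j]

end Spiked

/-! ### Eigendecompositions and truncation -/

section Spectral

variable {𝕜 : Type*} [RCLike 𝕜] {n : ℕ}

open scoped MatrixOrder Matrix.Norms.L2Operator in
theorem eq_of_mul_self_eq_mul_self {A B : Matrix (Fin n) (Fin n) 𝕜} (hA : A.PosSemidef)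
    (hB : B.PosSemidef) (h : A * A = B * B) : A = B :=
  (CFC.sqrt_unique h hA.nonneg).symm.trans (CFC.sqrt_unique rfl hB.nonneg)

theorem posSemidef_unitary_conj_diagonal {σ : Fin n → ℝ} (hσ : ∀ i, 0 ≤ σ i)
    (U : Matrix (Fin n) (Fin n) 𝕜) :
    (U * Matrix.diagonal (fun i => (σ i : 𝕜)) * Uᴴ).PosSemidef :=
  (Matrix.PosSemidef.diagonal (fun i => RCLike.ofReal_nonneg.2 (hσ i))).mul_mul_conjTranspose_same U

theorem conjTranspose_diagonal_ofReal (σ : Fin n → ℝ) :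
    (Matrix.diagonal (fun i => (σ i : 𝕜)))ᴴ = Matrix.diagonal (fun i => (σ i : 𝕜)) := by
  rw [Matrix.diagonal_conjTranspose]
  congr! 2 with i
  simp

/-- A truncated singular value decomposition of a psd matrix comes from its eigendecomposition. -/
theorem IsTruncatedSVD.exists_eigendecomposition {q : ℕ} {H B : Matrix (Fin n) (Fin n) 𝕜}
    (h : IsTruncatedSVD q H B) (hH : H.PosSemidef) :
    ∃ U ∈ Matrix.unitaryGroup (Fin n) 𝕜, ∃ σ : Fin n → ℝ, Antitone σ ∧ (∀ i, 0 ≤ σ i) ∧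
      H = U * Matrix.diagonal (fun i => (σ i : 𝕜)) * Uᴴ ∧
      RCLike.re (H - B).trace = ∑ i : Fin n, if i.val < q then 0 else σ i := by
  obtain ⟨U, hU, V, hV, σ, hanti, hσ, hHUV, hB⟩ := h
  refine ⟨U, hU, σ, hanti, hσ, ?_⟩
  have hU' : Uᴴ * U = 1 := Matrix.mem_unitaryGroup_iff'.1 hU
  have hV' : Vᴴ * V = 1 := Matrix.mem_unitaryGroup_iff'.1 hV
  set D := Matrix.diagonal (fun i => (σ i : 𝕜)) with hD
  have hDh : Dᴴ = D := conjTranspose_diagonal_ofReal σ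
  -- Both sides are psd with the same square, since H² = H Hᴴ removes V from the decomposition.
  have hHU : H = U * D * Uᴴ := by
    refine eq_of_mul_self_eq_mul_self hH (posSemidef_unitary_conj_diagonal hσ U) ?_
    calc H * H = H * Hᴴ := by rw [hH.1.eq]
      _ = U * D * (Vᴴ * V) * D * Uᴴ := by
        rw [hHUV]
        simp only [Matrix.conjTranspose_mul, Matrix.conjTranspose_conjTranspose, hDh,
          Matrix.mul_assoc]
      _ = U * D * (Uᴴ * U) * D * Uᴴ := by rw [hU', hV']
      _ = _ := by simp only [Matrix.mul_assoc]
  refine ⟨hHU, ?_⟩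
  -- V may differ from U on the kernel of H; only D Vᴴ is determined, and the truncation involves
  -- nothing else.
  have hDV : D * Vᴴ = D * Uᴴ := by
    have h1 : Uᴴ * (U * D * Vᴴ) = Uᴴ * (U * D * Uᴴ) := by rw [← hHUV, ← hHU]
    simpa only [← Matrix.mul_assoc, hU', Matrix.one_mul] using h1
  set E : Matrix (Fin n) (Fin n) 𝕜 := Matrix.diagonal (fun i => if i.val < q then 1 else 0) with hE
  have hED : Matrix.diagonal (fun i : Fin n => if i.val < q then (σ i : 𝕜) else 0) = E * D := by
    rw [hE, hD, Matrix.diagonal_mul_diagonal]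
    congr! 2 with i
    split_ifs <;> simp
  have hBU : B = U * (E * D) * Uᴴ := by
    rw [hB, hED, Matrix.mul_assoc, Matrix.mul_assoc, hDV]
    simp only [Matrix.mul_assoc]
  have hdiff : H - B = U * ((D - E * D) * Uᴴ) := by
    rw [hBU, hHU]
    simp only [Matrix.mul_sub, Matrix.sub_mul, Matrix.mul_assoc]
  rw [hdiff, Matrix.trace_mul_comm, Matrix.mul_assoc, hU', Matrix.mul_one, ← hED, hD,
    Matrix.diagonal_sub, Matrix.trace_diagonal, map_sum]
  refine Finset.sum_congr rfl fun i _ => ?_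
  split_ifs <;> simp

theorem exists_eigendecomposition (q : ℕ) {H : Matrix (Fin n) (Fin n) 𝕜} (hH : H.PosSemidef) :
    ∃ U ∈ Matrix.unitaryGroup (Fin n) 𝕜, ∃ σ : Fin n → ℝ, Antitone σ ∧ (∀ i, 0 ≤ σ i) ∧
      H = U * Matrix.diagonal (fun i => (σ i : 𝕜)) * Uᴴ ∧
      optimalError q H = ∑ i : Fin n, if i.val < q then 0 else σ i :=
  (isTruncatedSVD_lowRank q hH).exists_eigendecomposition hH

theorem charpoly_unitary_conj_diagonal {U : Matrix (Fin n) (Fin n) 𝕜}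
    (hU : U ∈ Matrix.unitaryGroup (Fin n) 𝕜) (σ : Fin n → ℝ) :
    (U * Matrix.diagonal (fun i => (σ i : 𝕜)) * Uᴴ).charpoly.roots =
      Finset.univ.val.map fun i => (σ i : 𝕜) := by
  have hU' : Uᴴ * U = 1 := Matrix.mem_unitaryGroup_iff'.1 hU
  rw [Matrix.charpoly_mul_comm, ← Matrix.mul_assoc, hU', Matrix.one_mul, Matrix.charpoly_diagonal,
    Finset.prod_eq_multiset_prod]
  rw [← Polynomial.roots_multiset_prod_X_sub_C (Finset.univ.val.map fun i => (σ i : 𝕜)),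
    Multiset.map_map]
  rfl

/-- The roots of the characteristic polynomial fix the multiset of eigenvalues, and sorting fixes
their order. Hence the optimal error does not depend on the decomposition chosen in `lowRank`. -/
theorem antitone_unique {U V : Matrix (Fin n) (Fin n) 𝕜}
    (hU : U ∈ Matrix.unitaryGroup (Fin n) 𝕜) (hV : V ∈ Matrix.unitaryGroup (Fin n) 𝕜)
    {σ τ : Fin n → ℝ} (hσ : Antitone σ) (hτ : Antitone τ)
    (h : U * Matrix.diagonal (fun i => (σ i : 𝕜)) * Uᴴ =
      V * Matrix.diagonal (fun i => (τ i : 𝕜)) * Vᴴ) : σ = τ := by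
  have h1 := charpoly_unitary_conj_diagonal hU σ
  rw [h, charpoly_unitary_conj_diagonal hV τ] at h1
  have h2 : Finset.univ.val.map τ = Finset.univ.val.map σ := by
    refine Multiset.map_injective (RCLike.ofReal_injective (K := 𝕜)) ?_
    rw [Multiset.map_map, Multiset.map_map]
    exact h1
  rw [Fin.univ_val_map, Fin.univ_val_map, Multiset.coe_eq_coe] at h2
  exact (List.ofFn_injective (h2.eq_of_sortedGE hτ.sortedGE_ofFn hσ.sortedGE_ofFn)).symm

theorem optimalError_unitary_conj {U : Matrix (Fin n) (Fin n) 𝕜}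
    (hU : U ∈ Matrix.unitaryGroup (Fin n) 𝕜) {σ : Fin n → ℝ} (hanti : Antitone σ)
    (hσ : ∀ i, 0 ≤ σ i) (q : ℕ) :
    optimalError q (U * Matrix.diagonal (fun i => (σ i : 𝕜)) * Uᴴ) =
      ∑ i : Fin n, if i.val < q then 0 else σ i := by
  obtain ⟨V, hV, τ, hτ, -, h, hopt⟩ :=
    exists_eigendecomposition q (posSemidef_unitary_conj_diagonal hσ U)
  rw [hopt, antitone_unique hU hV hanti hτ h]

theorem isUnit_det_of_mem_unitaryGroup {U : Matrix (Fin n) (Fin n) 𝕜}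
    (hU : U ∈ Matrix.unitaryGroup (Fin n) 𝕜) : IsUnit U.det :=
  (Matrix.isUnit_iff_isUnit_det U).1 (IsUnit.of_mul_eq_one _ (Matrix.mem_unitaryGroup_iff.1 hU))

theorem rank_unitary_conj_diagonal {U : Matrix (Fin n) (Fin n) 𝕜}
    (hU : U ∈ Matrix.unitaryGroup (Fin n) 𝕜) (σ : Fin n → ℝ) :
    (U * Matrix.diagonal (fun i => (σ i : 𝕜)) * Uᴴ).rank =
      (Finset.univ.filter fun i => σ i ≠ 0).card := by
  classical
  have h1 : IsUnit U.det := isUnit_det_of_mem_unitaryGroup hU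
  have h2 : IsUnit Uᴴ.det := isUnit_det_of_mem_unitaryGroup (Unitary.star_mem hU)
  rw [Matrix.rank_mul_eq_left_of_isUnit_det _ _ h2, Matrix.rank_mul_eq_right_of_isUnit_det _ _ h1,
    Matrix.rank_diagonal, Fintype.card_subtype]
  simp

theorem lt_card_iff_ne_zero {σ : Fin n → ℝ} (hanti : Antitone σ) (hσ : ∀ i, 0 ≤ σ i) (i : Fin n) :
    i.val < (Finset.univ.filter fun i => σ i ≠ 0).card ↔ σ i ≠ 0 := by
  constructor
  · intro h hi
    have : (Finset.univ.filter fun i => σ i ≠ 0) ⊆ Finset.Iio i := by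
      intro k hk
      rw [Finset.mem_Iio]
      by_contra hki
      exact (Finset.mem_filter.1 hk).2 (le_antisymm (hi ▸ hanti (not_lt.1 hki)) (hσ k))
    have := Finset.card_le_card this
    rw [Fin.card_Iio] at this
    omega
  · intro h
    have : Finset.Iic i ⊆ (Finset.univ.filter fun i => σ i ≠ 0) := by
      intro k hk
      have h1 := hanti (Finset.mem_Iic.1 hk)
      have h2 := (hσ i).lt_of_ne' h
      exact Finset.mem_filter.2 ⟨Finset.mem_univ k, (h2.trans_le h1).ne'⟩
    have := Finset.card_le_card this
    rw [Fin.card_Iic] at this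
    omega

end Spectral

/-! ### Concavity and symmetry of the expected error -/

section ExpectedError

variable {ι κ 𝕜 : Type*} [Fintype ι] [Fintype κ] [DecidableEq ι] [RCLike 𝕜]

/-- The expected trace error for the diagonal matrix with entries `c`. -/
noncomputable def expectedError (ν : Measure (Matrix ι κ 𝕜)) (c : ι → ℝ) : ENNReal :=
  ∫⁻ M, ENNReal.ofReal (∑ j, weightedDist c M (Pi.single j 1)) ∂ν

theorem measurable_sum_weightedDist {c : ι → ℝ} (hc : ∀ i, 0 ≤ c i) :
    Measurable fun M : Matrix ι κ 𝕜 => ∑ j, weightedDist c M (Pi.single j 1) :=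
  Finset.measurable_fun_sum _ fun _ _ => measurable_weightedDist_left hc _

theorem expectedError_mono (ν : Measure (Matrix ι κ 𝕜)) {c d : ι → ℝ} (hc : ∀ i, 0 ≤ c i)
    (hcd : ∀ i, c i ≤ d i) : expectedError ν c ≤ expectedError ν d :=
  lintegral_mono fun M => ENNReal.ofReal_le_ofReal
    (Finset.sum_le_sum fun _ _ => weightedDist_mono hc hcd M _)

theorem expectedError_smul (ν : Measure (Matrix ι κ 𝕜)) {c : ι → ℝ} (hc : ∀ i, 0 ≤ c i) {a : ℝ}
    (ha : 0 ≤ a) : expectedError ν (a • c) = ENNReal.ofReal a * expectedError ν c := by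
  simp_rw [expectedError, weightedDist_smul ha, ← Finset.mul_sum, ENNReal.ofReal_mul ha]
  exact lintegral_const_mul _ (measurable_sum_weightedDist hc).ennreal_ofReal

theorem sum_expectedError_le {τ : Type*} (s : Finset τ) (ν : Measure (Matrix ι κ 𝕜))
    {c : τ → ι → ℝ} (hc : ∀ k i, 0 ≤ c k i) :
    ∑ k ∈ s, expectedError ν (c k) ≤ expectedError ν (fun i => ∑ k ∈ s, c k i) := by
  simp_rw [expectedError]
  rw [← lintegral_finsetSum _ fun k _ => (measurable_sum_weightedDist (hc k)).ennreal_ofReal]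
  refine lintegral_mono fun M => ?_
  rw [← ENNReal.ofReal_sum_of_nonneg fun k _ =>
    Finset.sum_nonneg fun j _ => weightedDist_nonneg (hc k) M _, Finset.sum_comm]
  exact ENNReal.ofReal_le_ofReal
    (Finset.sum_le_sum fun j _ => sum_weightedDist_le s hc M _)

/-- Permuting the weights amounts to permuting the rows of M, which is multiplication by a unitary
matrix. -/
theorem IsUnitaryInvariant.expectedError_comp_perm {ν : Measure (Matrix ι κ 𝕜)}
    (hν : IsUnitaryInvariant ν) {c : ι → ℝ} (hc : ∀ i, 0 ≤ c i) (π : Equiv.Perm ι) :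
    expectedError ν (c ∘ π) = expectedError ν c := by
  have hU : π.symm.toPEquiv.toMatrix ∈ Matrix.unitaryGroup ι 𝕜 := by
    rw [Matrix.mem_unitaryGroup_iff]
    ext i j
    simp [Matrix.mul_apply, PEquiv.toMatrix_apply, Matrix.one_apply, Equiv.toPEquiv_apply]
  have h1 (M : Matrix ι κ 𝕜) : ∑ j, weightedDist (c ∘ π) M (Pi.single j 1) =
      ∑ j, weightedDist c ((π.symm.toPEquiv.toMatrix : Matrix ι ι 𝕜) * M) (Pi.single j 1) := by
    rw [← Equiv.sum_comp π.symm]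
    refine Finset.sum_congr rfl fun j _ => ?_
    rw [PEquiv.toMatrix_toPEquiv_mul, ← weightedDist_permMatrix]
    congr 1
    ext i
    simp [Pi.single_apply, Equiv.eq_symm_apply]
  simp_rw [expectedError, h1]
  exact hν.lintegral_mul hU (measurable_sum_weightedDist hc).ennreal_ofReal

theorem card_mul_sum_perm {τ : Type*} [Fintype τ] [DecidableEq τ] (f : τ → ℝ) (i : τ) :
    (Fintype.card τ : ℝ) * ∑ π : Equiv.Perm τ, f (π i) =
      Fintype.card (Equiv.Perm τ) * ∑ k, f k := by
  have h1 (k : τ) : ∑ π : Equiv.Perm τ, f (π k) = ∑ π : Equiv.Perm τ, f (π i) := by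
    rw [← Equiv.sum_comp (Equiv.mulRight (Equiv.swap i k))]
    simp
  have h2 : ∑ k, ∑ π : Equiv.Perm τ, f (π k) = Fintype.card (Equiv.Perm τ) * ∑ k, f k := by
    rw [Finset.sum_comm]
    simp_rw [Equiv.sum_comp]
    simp
  rw [← h2, Finset.sum_congr rfl fun k _ => h1 k]
  simp

/-- By concavity and symmetry, averaging the weights over `T` increases the expected error. -/
theorem IsUnitaryInvariant.expectedError_le_average {ν : Measure (Matrix ι κ 𝕜)}
    (hν : IsUnitaryInvariant ν) {c : ι → ℝ} (hc : ∀ i, 0 ≤ c i) (T : Finset ι) :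
    expectedError ν c ≤
      expectedError ν (fun i => if i ∈ T then (∑ k ∈ T, c k) / T.card else c i) := by
  set d : ι → ℝ := fun i => if i ∈ T then (∑ k ∈ T, c k) / T.card else c i with hd
  have hd0 : ∀ i, 0 ≤ d i := by
    intro i
    simp only [hd]
    split_ifs
    · exact div_nonneg (Finset.sum_nonneg fun k _ => hc k) (Nat.cast_nonneg _)
    · exact hc i
  set N : ℕ := Fintype.card (Equiv.Perm T) with hN
  have hN0 : N ≠ 0 := Fintype.card_ne_zero
  -- Summing over all permutations of T gives N = |T|! times the averaged weights; superadditivity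
  -- against N equal terms then gives the bound, and N cancels.
  have hsum : (fun i => ∑ π : Equiv.Perm T, (c ∘ Equiv.Perm.ofSubtype π) i) = (N : ℝ) • d := by
    ext i
    rw [Pi.smul_apply, smul_eq_mul]
    by_cases hi : i ∈ T
    · have hcard : (T.card : ℝ) ≠ 0 := by
        exact_mod_cast (Finset.card_pos.2 ⟨i, hi⟩).ne'
      have := card_mul_sum_perm (fun k : T => c k) ⟨i, hi⟩
      rw [Fintype.card_coe, Finset.sum_coe_sort T] at this
      have h2 : ∀ π : Equiv.Perm T, (c ∘ Equiv.Perm.ofSubtype π) i = c (π ⟨i, hi⟩) := fun π => by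
        rw [Function.comp_apply, Equiv.Perm.ofSubtype_apply_of_mem π hi]
      simp_rw [h2]
      simp only [hd, if_pos hi]
      field_simp
      linarith
    · have h2 : ∀ π : Equiv.Perm T, (c ∘ Equiv.Perm.ofSubtype π) i = c i := fun π => by
        rw [Function.comp_apply, Equiv.Perm.ofSubtype_apply_of_not_mem π hi]
      simp_rw [h2]
      simp [hd, hi, hN]
  have key := sum_expectedError_le Finset.univ ν
    (c := fun π : Equiv.Perm T => c ∘ Equiv.Perm.ofSubtype π) fun π i => hc _
  rw [hsum, expectedError_smul ν hd0 N.cast_nonneg,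
    Finset.sum_congr rfl fun π _ => hν.expectedError_comp_perm hc (Equiv.Perm.ofSubtype π),
    Finset.sum_const, nsmul_eq_mul, Finset.card_univ, ENNReal.ofReal_natCast] at key
  exact (ENNReal.mul_le_mul_iff_right (by exact_mod_cast hN0) (ENNReal.natCast_ne_top N)).1 key

end ExpectedError

/-! ### The law of the embedding, measurability and integrability -/

section Law

variable {𝕜 : Type*} [RCLike 𝕜] {Ω' : Type*} [MeasurableSpace Ω'] {n ℓ : ℕ}

/-- Full column rank means independent columns, which is an open condition. -/
theorem measurableSet_rank_eq : MeasurableSet {M : Matrix (Fin n) (Fin ℓ) 𝕜 | M.rank = ℓ} := by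
  have h : {M : Matrix (Fin n) (Fin ℓ) 𝕜 | M.rank = ℓ} =
      {M : Matrix (Fin n) (Fin ℓ) 𝕜 | LinearIndependent 𝕜 M.col} := by
    ext M
    simp only [Set.mem_ofPred_eq]
    rw [linearIndependent_iff_card_eq_finrank_span, Matrix.rank_eq_finrank_span_cols,
      Fintype.card_fin, eq_comm]
    rfl
  rw [h]
  have hcont : Continuous fun M : Matrix (Fin n) (Fin ℓ) 𝕜 => M.col := by
    refine continuous_pi fun j => continuous_pi fun i => ?_
    exact (continuous_apply j).comp (continuous_apply i)
  exact (isOpen_setOfPred_linearIndependent.preimage hcont).measurableSet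

theorem IsFullRankRandomEmbedding.ae_rank_map {P : Measure Ω'} {Ω : Ω' → Matrix (Fin n) (Fin ℓ) 𝕜}
    (hΩ : IsFullRankRandomEmbedding P Ω) : ∀ᵐ M ∂P.map Ω, M.rank = Fintype.card (Fin ℓ) := by
  rw [Fintype.card_fin]
  exact (ae_map_iff hΩ.aemeasurable measurableSet_rank_eq).2 hΩ.rank_eq

theorem IsRotationInvariant.isUnitaryInvariant_map {P : Measure Ω'}
    {Ω : Ω' → Matrix (Fin n) (Fin ℓ) 𝕜} (hΩ : IsRotationInvariant P Ω) (hm : AEMeasurable Ω P) :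
    IsUnitaryInvariant (P.map Ω) := by
  intro U hU
  rw [AEMeasurable.map_map_of_aemeasurable (measurable_const_mul_matrix U).aemeasurable hm]
  exact (hΩ U hU).map_eq

theorem measurable_nystromError {H : Matrix (Fin n) (Fin n) 𝕜} (hH : H.PosSemidef) :
    Measurable fun M : Matrix (Fin n) (Fin ℓ) 𝕜 => nystromError H M := by
  obtain ⟨U, hU, σ, -, hσ, rfl, -⟩ := exists_eigendecomposition 0 hH
  simp_rw [nystromError_unitary_conj hU, nystromError_diagonal hσ]
  exact (measurable_sum_weightedDist hσ).comp (measurable_const_mul_matrix _)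

theorem nystromError_nonneg {H : Matrix (Fin n) (Fin n) 𝕜} (hH : H.PosSemidef)
    (M : Matrix (Fin n) (Fin ℓ) 𝕜) : 0 ≤ nystromError H M := by
  obtain ⟨U, hU, σ, -, hσ, rfl, -⟩ := exists_eigendecomposition 0 hH
  rw [nystromError_unitary_conj hU, nystromError_diagonal hσ]
  exact Finset.sum_nonneg fun j _ => weightedDist_nonneg hσ _ _

theorem exists_nystromError_le {H : Matrix (Fin n) (Fin n) 𝕜} (hH : H.PosSemidef) :
    ∃ C, ∀ M : Matrix (Fin n) (Fin ℓ) 𝕜, nystromError H M ≤ C := by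
  obtain ⟨U, hU, σ, -, hσ, rfl, -⟩ := exists_eigendecomposition 0 hH
  refine ⟨∑ j, σ j, fun M => ?_⟩
  rw [nystromError_unitary_conj hU, nystromError_diagonal hσ]
  exact Finset.sum_le_sum fun j _ => weightedDist_single_le hσ _ j

theorem integrable_nystromError {P : Measure Ω'} [IsFiniteMeasure P]
    {Ω : Ω' → Matrix (Fin n) (Fin ℓ) 𝕜} (hΩ : AEMeasurable Ω P) {H : Matrix (Fin n) (Fin n) 𝕜}
    (hH : H.PosSemidef) : Integrable (fun ω => nystromError H (Ω ω)) P := by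
  obtain ⟨C, hC⟩ := exists_nystromError_le (ℓ := ℓ) hH
  refine Integrable.of_bound
    ((measurable_nystromError hH).comp_aemeasurable hΩ).aestronglyMeasurable C
    (Filter.Eventually.of_forall fun ω => ?_)
  rw [Real.norm_eq_abs, abs_of_nonneg (nystromError_nonneg hH _)]
  exact hC _

theorem ofReal_integral_nystromError {P : Measure Ω'} [IsFiniteMeasure P]
    {Ω : Ω' → Matrix (Fin n) (Fin ℓ) 𝕜} (hΩ : AEMeasurable Ω P) {H : Matrix (Fin n) (Fin n) 𝕜}
    (hH : H.PosSemidef) :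
    ENNReal.ofReal (∫ ω, nystromError H (Ω ω) ∂P) =
      ∫⁻ M, ENNReal.ofReal (nystromError H M) ∂P.map Ω := by
  rw [ofReal_integral_eq_lintegral_ofReal (integrable_nystromError hΩ hH)
    (Filter.Eventually.of_forall fun ω => nystromError_nonneg hH _),
    lintegral_map' (measurable_nystromError hH).ennreal_ofReal.aemeasurable hΩ]

end Law

/-! ### Reduction of a general spectrum to a spiked one -/

section SpikedSpectrum

variable {𝕜 : Type*} [RCLike 𝕜] {n ℓ : ℕ}

/-- The first `q` indices. -/
def headIndices (n q : ℕ) : Finset (Fin n) := Finset.univ.filter fun i => i.val < q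

/-- The indices from `q` up to (not including) `r`. -/
def tailIndices (n q r : ℕ) : Finset (Fin n) := Finset.univ.filter fun i => q ≤ i.val ∧ i.val < r

theorem card_headIndices {n q : ℕ} (hq : q ≤ n) : (headIndices n q).card = q := by
  rw [headIndices, Fin.card_filter_val_lt, min_eq_right hq]

theorem disjoint_headIndices_tailIndices (n q r : ℕ) :
    Disjoint (headIndices n q) (tailIndices n q r) := by
  rw [Finset.disjoint_left]
  intro i hi hi'
  simp only [headIndices, tailIndices, Finset.mem_filter, Finset.mem_univ, true_and] at hi hi'
  omega

theorem card_tailIndices {n q r : ℕ} (hq : q ≤ r) (hr : r ≤ n) :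
    q + (tailIndices n q r).card = r := by
  have h : headIndices n q ∪ tailIndices n q r = headIndices n r := by
    ext i
    simp only [headIndices, tailIndices, Finset.mem_union, Finset.mem_filter, Finset.mem_univ,
      true_and]
    omega
  have := Finset.card_union_of_disjoint (disjoint_headIndices_tailIndices n q r)
  rw [h, card_headIndices hr, card_headIndices (hq.trans hr)] at this
  exact this.symm

/-- The weights with `q` entries equal to `t`, followed by ones up to position `r`. -/
def spikedWeight (n q r : ℕ) (t : ℝ) : Fin n → ℝ :=
  penaltyWeight (headIndices n q) (tailIndices n q r) t

theorem spikedWeight_apply (n q r : ℕ) (t : ℝ) (i : Fin n) :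
    spikedWeight n q r t i = if i.val < q then t else if i.val < r then 1 else 0 := by
  simp only [spikedWeight, penaltyWeight, headIndices, tailIndices, Finset.mem_filter,
    Finset.mem_univ, true_and]
  by_cases h1 : i.val < q
  · simp [h1]
  · simp [h1, not_lt.1 h1]

theorem spikedWeight_nonneg (n q r : ℕ) {t : ℝ} (ht : 0 ≤ t) (i : Fin n) :
    0 ≤ spikedWeight n q r t i := penaltyWeight_nonneg _ _ ht i

theorem antitone_spikedWeight (n q r : ℕ) {t : ℝ} (ht : 1 ≤ t) :
    Antitone (spikedWeight n q r t) := by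
  intro i j hij
  have hij' : i.val ≤ j.val := hij
  rw [spikedWeight_apply, spikedWeight_apply]
  split_ifs <;> first | omega | linarith

theorem card_spikedWeight_ne_zero {q r : ℕ} (hq : q ≤ r) (hr : r ≤ n) {t : ℝ} (ht : 1 ≤ t) :
    (Finset.univ.filter fun i => spikedWeight n q r t i ≠ 0).card = r := by
  have h : (Finset.univ.filter fun i => spikedWeight n q r t i ≠ 0) = headIndices n r := by
    ext i
    simp only [headIndices, Finset.mem_filter, Finset.mem_univ, true_and, spikedWeight_apply]
    by_cases h1 : i.val < q
    · simp [h1, h1.trans_le hq, (zero_lt_one.trans_le ht).ne']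
    · simp [h1]
  rw [h, card_headIndices hr]

theorem sum_spikedWeight_tail {q r : ℕ} (hq : q ≤ r) (hr : r ≤ n) (t : ℝ) :
    ∑ i : Fin n, (if i.val < q then 0 else spikedWeight n q r t i) = (r : ℝ) - q := by
  have h : ∀ i : Fin n, (if i.val < q then 0 else spikedWeight n q r t i) =
      if i ∈ tailIndices n q r then 1 else 0 := by
    intro i
    simp only [spikedWeight_apply, tailIndices, Finset.mem_filter, Finset.mem_univ, true_and]
    by_cases h1 : i.val < q
    · simp [h1]
    · simp [h1, not_lt.1 h1]
  simp_rw [h]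
  rw [Finset.sum_boole, Finset.filter_mem_eq_inter, Finset.univ_inter]
  have := card_tailIndices hq hr
  rw [eq_sub_iff_add_eq, add_comm]
  exact_mod_cast this

theorem sharpConst_mul {α q r ℓ : ℕ} (hqr : q < r) :
    sharpConst α q r ℓ * ((r : ℝ) - q) = ((r : ℝ) - ℓ) * (1 + q / ((ℓ : ℝ) - q - α)) := by
  have : (r : ℝ) - q ≠ 0 := by
    rw [sub_ne_zero]; exact_mod_cast hqr.ne'
  rw [sharpConst]
  field_simp

theorem IsUnitaryInvariant.expectedError_spikedWeight_le
    {ν : Measure (Matrix (Fin n) (Fin ℓ) 𝕜)} [IsProbabilityMeasure ν] (hν : IsUnitaryInvariant ν)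
    (hrank : ∀ᵐ M ∂ν, M.rank = Fintype.card (Fin ℓ)) {q r : ℕ} (hα : q + fieldAlpha 𝕜 < ℓ)
    (hle : ℓ ≤ r) (hr : r ≤ n) {t : ℕ} (ht : 0 < t) :
    expectedError ν (spikedWeight n q r t) ≤
      ENNReal.ofReal (sharpConst (fieldAlpha 𝕜) q r ℓ * ((r : ℝ) - q)) := by
  have hT := card_tailIndices (n := n) (q := q) (by omega) hr
  have hQ := card_headIndices (n := n) (q := q) (by omega)
  have h := hν.lintegral_sum_weightedDist_le hrank (disjoint_headIndices_tailIndices n q r)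
    (by rwa [hQ, Fintype.card_fin]) (by rw [hQ, hT, Fintype.card_fin]; exact hle) ht
  have hr' : (q : ℝ) + (tailIndices n q r).card = r := by exact_mod_cast hT
  rw [hQ, Fintype.card_fin, hr'] at h
  rwa [sharpConst_mul (by omega)]

theorem IsUnitaryInvariant.tendsto_expectedError_spikedWeight
    {ν : Measure (Matrix (Fin n) (Fin ℓ) 𝕜)} [IsProbabilityMeasure ν] (hν : IsUnitaryInvariant ν)
    (hrank : ∀ᵐ M ∂ν, M.rank = Fintype.card (Fin ℓ)) {q r : ℕ} (hα : q + fieldAlpha 𝕜 < ℓ)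
    (hle : ℓ ≤ r) (hr : r ≤ n) :
    Filter.Tendsto (fun t : ℕ => expectedError ν (spikedWeight n q r t)) Filter.atTop
      (nhds (ENNReal.ofReal (sharpConst (fieldAlpha 𝕜) q r ℓ * ((r : ℝ) - q)))) := by
  have hT := card_tailIndices (n := n) (q := q) (by omega) hr
  have hQ := card_headIndices (n := n) (q := q) (by omega)
  have h := hν.tendsto_lintegral_sum_weightedDist hrank (disjoint_headIndices_tailIndices n q r)
    (by rwa [hQ, Fintype.card_fin]) (by rw [hQ, hT, Fintype.card_fin]; exact hle)
  have hr' : (q : ℝ) + (tailIndices n q r).card = r := by exact_mod_cast hT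
  rw [hQ, Fintype.card_fin, hr'] at h
  rwa [sharpConst_mul (by omega)]

theorem sharpConst_nonneg {α q r ℓ : ℕ} (hα : q + α < ℓ) (hle : ℓ ≤ r) :
    0 ≤ sharpConst α q r ℓ := by
  have h1 : (q : ℝ) + α < ℓ := by exact_mod_cast hα
  have h2 : (ℓ : ℝ) ≤ r := by exact_mod_cast hle
  have h3 : (0 : ℝ) ≤ α := α.cast_nonneg
  refine mul_nonneg (div_nonneg (by linarith) (by linarith))
    (add_nonneg zero_le_one (div_nonneg q.cast_nonneg (by linarith)))

/-- Upper bound for the expected error of a diagonal matrix with decreasing entries. -/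
theorem IsUnitaryInvariant.expectedError_le
    {ν : Measure (Matrix (Fin n) (Fin ℓ) 𝕜)} [IsProbabilityMeasure ν] (hν : IsUnitaryInvariant ν)
    (hrank : ∀ᵐ M ∂ν, M.rank = Fintype.card (Fin ℓ)) {q r : ℕ} (hα : q + fieldAlpha 𝕜 < ℓ)
    (hle : ℓ ≤ r) (hr : r ≤ n) {σ : Fin n → ℝ} (hσ : ∀ i, 0 ≤ σ i)
    (hσr : ∀ i : Fin n, i.val < r ↔ σ i ≠ 0) :
    expectedError ν σ ≤ ENNReal.ofReal (sharpConst (fieldAlpha 𝕜) q r ℓ *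
      ∑ i : Fin n, if i.val < q then 0 else σ i) := by
  have hqr : q < r := by omega
  set T := tailIndices n q r with hTdef
  have hmemT (i : Fin n) : i ∈ T ↔ q ≤ i.val ∧ i.val < r := by
    simp [hTdef, tailIndices]
  have hT : (T.card : ℝ) = (r : ℝ) - q := by
    rw [eq_sub_iff_add_eq, add_comm]
    exact_mod_cast card_tailIndices hqr.le hr
  have hTpos : (0 : ℝ) < (r : ℝ) - q := by
    rw [sub_pos]; exact_mod_cast hqr
  have hsumT : ∑ i : Fin n, (if i.val < q then 0 else σ i) = ∑ k ∈ T, σ k := by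
    rw [← Finset.univ_inter T, ← Finset.sum_ite_mem]
    refine Finset.sum_congr rfl fun i _ => ?_
    by_cases h1 : i.val < q
    · simp [h1, hmemT, not_le.2 h1]
    · by_cases h2 : i.val < r
      · simp [h1, h2, hmemT, not_lt.1 h1]
      · have : σ i = 0 := by
          by_contra h
          exact h2 ((hσr i).2 h)
        simp [this]
  have hpos : 0 < ∑ k ∈ T, σ k := by
    have hmem : (⟨q, by omega⟩ : Fin n) ∈ T := (hmemT _).2 ⟨le_rfl, hqr⟩
    exact Finset.sum_pos' (fun k _ => hσ k)
      ⟨_, hmem, (hσ _).lt_of_ne' ((hσr _).1 hqr)⟩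
  set m := (∑ k ∈ T, σ k) / T.card with hm
  have hm0 : 0 < m := by rw [hm, hT]; exact div_pos hpos hTpos
  -- With this t the spike height m t dominates every eigenvalue; the added 1 keeps t positive. The
  -- spiked bound is uniform in t, so a large t costs nothing.
  obtain ⟨t, ht⟩ := exists_nat_ge (1 + (∑ i, σ i) / m)
  have hquot : 0 ≤ (∑ i, σ i) / m := div_nonneg (Finset.sum_nonneg fun i _ => hσ i) hm0.le
  have ht0 : 0 < t := by
    have : (0 : ℝ) < t := by linarith
    exact_mod_cast this
  have hbound : ∀ i : Fin n, σ i ≤ m * t := by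
    intro i
    have h1 : σ i ≤ ∑ i, σ i := Finset.single_le_sum (fun i _ => hσ i) (Finset.mem_univ i)
    have h2 : (∑ i, σ i) / m ≤ t := by linarith
    rw [div_le_iff₀ hm0] at h2
    linarith
  calc expectedError ν σ ≤ expectedError ν (fun i => if i ∈ T then m else σ i) :=
        hν.expectedError_le_average hσ T
    _ ≤ expectedError ν (m • spikedWeight n q r t) := by
        refine expectedError_mono ν (fun i => ?_) fun i => ?_
        · split_ifs
          · exact hm0.le
          · exact hσ i
        · rw [Pi.smul_apply, spikedWeight_apply, smul_eq_mul]
          by_cases h1 : i.val < q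
          · rw [if_neg (by simp [hmemT, not_le.2 h1]), if_pos h1]
            exact hbound i
          · by_cases h2 : i.val < r
            · simp [h1, h2, hmemT, not_lt.1 h1]
            · have : σ i = 0 := by
                by_contra h
                exact h2 ((hσr i).2 h)
              simp [h1, h2, hmemT, this]
    _ = ENNReal.ofReal m * expectedError ν (spikedWeight n q r t) :=
        expectedError_smul ν (spikedWeight_nonneg n q r t.cast_nonneg) hm0.le
    _ ≤ ENNReal.ofReal m *
        ENNReal.ofReal (sharpConst (fieldAlpha 𝕜) q r ℓ * ((r : ℝ) - q)) :=
        mul_le_mul_right (hν.expectedError_spikedWeight_le hrank hα hle hr ht0) _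
    _ = _ := by
        rw [← ENNReal.ofReal_mul hm0.le, hsumT, hm, hT]
        congr 1
        field_simp

end SpikedSpectrum

/-! ### Haar randomization of an arbitrary embedding -/

section Haar

variable {𝕜 : Type*} [RCLike 𝕜] {n ℓ : ℕ}

instance compactSpace_unitaryGroup : CompactSpace (Matrix.unitaryGroup (Fin n) 𝕜) := by
  refine isCompact_iff_compactSpace.1 (?_ : IsCompact
    (Matrix.unitaryGroup (Fin n) 𝕜 : Set (Matrix (Fin n) (Fin n) 𝕜)))
  have hbox : IsCompact (Set.univ.pi fun _ : Fin n => Set.univ.pi fun _ : Fin n =>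
      Metric.closedBall (0 : 𝕜) 1) :=
    isCompact_univ_pi fun _ => isCompact_univ_pi fun _ => isCompact_closedBall _ _
  have hclosed : IsClosed (Matrix.unitaryGroup (Fin n) 𝕜 : Set (Matrix (Fin n) (Fin n) 𝕜)) := by
    have : (Matrix.unitaryGroup (Fin n) 𝕜 : Set (Matrix (Fin n) (Fin n) 𝕜)) =
        {U | U * Uᴴ = 1} := by
      ext U
      exact Matrix.mem_unitaryGroup_iff
    rw [this]
    exact isClosed_eq (continuous_id.matrix_mul continuous_id.matrix_conjTranspose)
      continuous_const
  refine hbox.of_isClosed_subset hclosed fun U hU => ?_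
  simp only [Set.mem_pi, Set.mem_univ, forall_true_left, mem_closedBall_zero_iff]
  exact fun i j => entry_norm_bound_of_unitary hU i j

/-- The normalized Haar measure on the unitary group. -/
noncomputable def unitaryHaar (𝕜 : Type*) [RCLike 𝕜] (n : ℕ) :
    Measure (Matrix.unitaryGroup (Fin n) 𝕜) :=
  Measure.haarMeasure ⊤

instance isProbabilityMeasure_unitaryHaar : IsProbabilityMeasure (unitaryHaar 𝕜 n) :=
  ⟨by simpa [unitaryHaar] using Measure.haarMeasure_self (K₀ := (⊤ : TopologicalSpace.PositiveCompacts
    (Matrix.unitaryGroup (Fin n) 𝕜)))⟩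

instance isMulLeftInvariant_unitaryHaar : (unitaryHaar 𝕜 n).IsMulLeftInvariant :=
  Measure.isMulLeftInvariant_haarMeasure _

theorem measurable_unitary_mul : Measurable
    fun p : Matrix.unitaryGroup (Fin n) 𝕜 × Matrix (Fin n) (Fin ℓ) 𝕜 =>
      (p.1 : Matrix (Fin n) (Fin n) 𝕜) * p.2 :=
  ((continuous_subtype_val.comp continuous_fst).matrix_mul continuous_snd).measurable

/-- The law of `U * M`, where `U` is Haar distributed and independent of `M`. -/
noncomputable def randomRotation (ν : Measure (Matrix (Fin n) (Fin ℓ) 𝕜)) :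
    Measure (Matrix (Fin n) (Fin ℓ) 𝕜) :=
  ((unitaryHaar 𝕜 n).prod ν).map fun p => (p.1 : Matrix (Fin n) (Fin n) 𝕜) * p.2

instance isProbabilityMeasure_randomRotation (ν : Measure (Matrix (Fin n) (Fin ℓ) 𝕜))
    [IsProbabilityMeasure ν] : IsProbabilityMeasure (randomRotation ν) :=
  Measure.isProbabilityMeasure_map measurable_unitary_mul.aemeasurable

theorem lintegral_randomRotation (ν : Measure (Matrix (Fin n) (Fin ℓ) 𝕜)) [SFinite ν]
    {f : Matrix (Fin n) (Fin ℓ) 𝕜 → ENNReal} (hf : Measurable f) :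
    ∫⁻ M, f M ∂randomRotation ν =
      ∫⁻ U : Matrix.unitaryGroup (Fin n) 𝕜, ∫⁻ M, f ((U : Matrix (Fin n) (Fin n) 𝕜) * M) ∂ν
        ∂unitaryHaar 𝕜 n := by
  rw [randomRotation, lintegral_map hf measurable_unitary_mul,
    lintegral_prod (fun p : Matrix.unitaryGroup (Fin n) 𝕜 × Matrix (Fin n) (Fin ℓ) 𝕜 =>
      f ((p.1 : Matrix (Fin n) (Fin n) 𝕜) * p.2)) (hf.comp measurable_unitary_mul).aemeasurable]

theorem isUnitaryInvariant_randomRotation (ν : Measure (Matrix (Fin n) (Fin ℓ) 𝕜)) [SFinite ν] :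
    IsUnitaryInvariant (randomRotation ν) := by
  intro V hV
  refine Measure.ext_of_lintegral _ fun f hf => ?_
  rw [lintegral_map hf (measurable_const_mul_matrix V),
    lintegral_randomRotation ν (f := fun M => f (V * M)) (hf.comp (measurable_const_mul_matrix V)),
    lintegral_randomRotation ν hf,
    ← lintegral_mul_left_eq_self (μ := unitaryHaar 𝕜 n)
      (fun U : Matrix.unitaryGroup (Fin n) 𝕜 =>
        ∫⁻ M, f ((U : Matrix (Fin n) (Fin n) 𝕜) * M) ∂ν) ⟨V, hV⟩]
  simp only [Submonoid.coe_mul, Matrix.mul_assoc]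

theorem ae_rank_randomRotation {ν : Measure (Matrix (Fin n) (Fin ℓ) 𝕜)} [SFinite ν]
    (hν : ∀ᵐ M ∂ν, M.rank = Fintype.card (Fin ℓ)) :
    ∀ᵐ M ∂randomRotation ν, M.rank = Fintype.card (Fin ℓ) := by
  rw [Fintype.card_fin] at hν ⊢
  rw [randomRotation, ae_map_iff measurable_unitary_mul.aemeasurable measurableSet_rank_eq]
  have h : ∀ᵐ p ∂(unitaryHaar 𝕜 n).prod ν, p.2.rank = ℓ :=
    Measure.quasiMeasurePreserving_snd.ae hν
  filter_upwards [h] with p hp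
  rw [Matrix.rank_mul_eq_right_of_isUnit_det _ _ (isUnit_det_of_mem_unitaryGroup p.1.2), hp]

/-- Rotating the embedding by U is the same as conjugating the psd matrix by the adjoint of U, and
an average over the Haar probability measure cannot exceed a uniform bound. -/
theorem expectedError_randomRotation_le {ν : Measure (Matrix (Fin n) (Fin ℓ) 𝕜)} [SFinite ν]
    {c : Fin n → ℝ} (hc : ∀ i, 0 ≤ c i) {K : ENNReal}
    (h : ∀ U ∈ Matrix.unitaryGroup (Fin n) 𝕜, ∫⁻ M, ENNReal.ofReal (nystromError
      (U * Matrix.diagonal (fun i => (c i : 𝕜)) * Uᴴ) M) ∂ν ≤ K) :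
    expectedError (randomRotation ν) c ≤ K := by
  rw [expectedError, lintegral_randomRotation ν (measurable_sum_weightedDist hc).ennreal_ofReal]
  calc _ ≤ ∫⁻ _ : Matrix.unitaryGroup (Fin n) 𝕜, K ∂unitaryHaar 𝕜 n := by
        refine lintegral_mono fun U => ?_
        have hU : star (U : Matrix (Fin n) (Fin n) 𝕜) ∈ Matrix.unitaryGroup (Fin n) 𝕜 :=
          (star U).2
        have := h _ hU
        simp_rw [nystromError_unitary_conj hU, nystromError_diagonal hc,
          Matrix.star_eq_conjTranspose, Matrix.conjTranspose_conjTranspose] at this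
        exact this
    _ = K := by simp

end Haar

end Nystrom

/-! ### The theorem -/

theorem theorem3p6 {𝕜 : Type*} [RCLike 𝕜] {Ω' : Type*} [MeasurableSpace Ω']
    (P : MeasureTheory.Measure Ω') [MeasureTheory.IsProbabilityMeasure P] (n ℓ : ℕ)
    (Ω : Ω' → Matrix (Fin n) (Fin ℓ) 𝕜) (hΩ : Nystrom.IsFullRankRandomEmbedding P Ω) :
    -- the expectations below are those of integrable random variables
    (∀ H : Matrix (Fin n) (Fin n) 𝕜, H.PosSemidef →
      MeasureTheory.Integrable (fun ω => Nystrom.nystromError H (Ω ω)) P) ∧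
    -- (a) sharp upper bound
    (Nystrom.IsRotationInvariant P Ω →
      ∀ H : Matrix (Fin n) (Fin n) 𝕜, H.PosSemidef → ℓ ≤ H.rank →
        ((∫ ω, Nystrom.nystromError H (Ω ω) ∂P : ℝ) : EReal) ≤
          ⨅ q : {q : ℕ // q + Nystrom.fieldAlpha 𝕜 < ℓ},
            ((Nystrom.sharpConst (Nystrom.fieldAlpha 𝕜) q H.rank ℓ *
              Nystrom.optimalError q H : ℝ) : EReal)) ∧
    -- (b) sharp lower bound
    (∀ q r : ℕ, q + Nystrom.fieldAlpha 𝕜 < ℓ → ℓ ≤ r → r ≤ n →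
      ((Nystrom.sharpConst (Nystrom.fieldAlpha 𝕜) q r ℓ : ℝ) : EReal) ≤
        ⨆ H : {H : Matrix (Fin n) (Fin n) 𝕜 // H.PosSemidef ∧ H.rank = r},
          (((∫ ω, Nystrom.nystromError H.1 (Ω ω) ∂P) / Nystrom.optimalError q H.1 : ℝ) : EReal)) := by
  have hm := hΩ.aemeasurable
  have hprob : IsProbabilityMeasure (P.map Ω) := Measure.isProbabilityMeasure_map hm
  have hrank := hΩ.ae_rank_map
  refine ⟨fun H hH => Nystrom.integrable_nystromError hm hH, ?_, ?_⟩
  · intro hinv H hH hle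
    have hν := hinv.isUnitaryInvariant_map hm
    refine le_iInf fun q => ?_
    rw [EReal.coe_le_coe_iff]
    obtain ⟨U, hU, σ, hanti, hσ, hHU, hopt⟩ := Nystrom.exists_eigendecomposition q.1 hH
    have hcard : H.rank = (Finset.univ.filter fun i => σ i ≠ 0).card := by
      rw [hHU, Nystrom.rank_unitary_conj_diagonal hU]
    have hrn : H.rank ≤ n := by simpa using H.rank_le_width
    have hbound := hν.expectedError_le hrank q.2 hle hrn hσ fun i => by
      rw [hcard]; exact Nystrom.lt_card_iff_ne_zero hanti hσ i
    have hnonneg : 0 ≤ Nystrom.sharpConst (Nystrom.fieldAlpha 𝕜) q.1 H.rank ℓ *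
        Nystrom.optimalError q.1 H := by
      refine mul_nonneg (Nystrom.sharpConst_nonneg q.2 hle) ?_
      rw [hopt]
      exact Finset.sum_nonneg fun i _ => by split_ifs <;> simp [hσ i]
    rw [← ENNReal.ofReal_le_ofReal_iff hnonneg, Nystrom.ofReal_integral_nystromError hm hH, hopt]
    have hUs : Uᴴ ∈ Matrix.unitaryGroup (Fin n) 𝕜 := Unitary.star_mem hU
    refine le_trans (le_of_eq ?_) hbound
    rw [Nystrom.expectedError, ← hν.lintegral_mul hUs
      (Nystrom.measurable_sum_weightedDist hσ).ennreal_ofReal]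
    refine lintegral_congr fun M => ?_
    rw [hHU, Nystrom.nystromError_unitary_conj hU, Nystrom.nystromError_diagonal hσ]
  · intro q r hα hle hr
    by_contra! hlt
    -- A real x strictly between the supremum and the constant bounds the error of every conjugate
    -- of every spiked matrix by x (r - q), r - q being their optimal error. This turns an
    -- extended-real supremum into real inequalities that survive Haar averaging and t → ∞.
    obtain ⟨x, hx1, hx2⟩ := EReal.lt_iff_exists_real_btwn.1 hlt
    rw [EReal.coe_lt_coe_iff] at hx2
    have hqr : q < r := by omega
    have hqr' : (0 : ℝ) < (r : ℝ) - q := by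
      rw [sub_pos]; exact_mod_cast hqr
    have hint (t : ℕ) (ht : 1 ≤ t) (U : Matrix (Fin n) (Fin n) 𝕜)
        (hU : U ∈ Matrix.unitaryGroup (Fin n) 𝕜) :
        ∫ ω, Nystrom.nystromError (U * Matrix.diagonal
          (fun i => (Nystrom.spikedWeight n q r t i : 𝕜)) * Uᴴ) (Ω ω) ∂P ≤ x * ((r : ℝ) - q) := by
      have ht' : (1 : ℝ) ≤ t := by exact_mod_cast ht
      have hc := Nystrom.spikedWeight_nonneg n q r (zero_le_one.trans ht')
      have hpsd := Nystrom.posSemidef_unitary_conj_diagonal hc U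
      have hrk := (Nystrom.rank_unitary_conj_diagonal hU (Nystrom.spikedWeight n q r t)).trans
        (Nystrom.card_spikedWeight_ne_zero hqr.le hr ht')
      have hopt := (Nystrom.optimalError_unitary_conj hU
        (Nystrom.antitone_spikedWeight n q r ht') hc q).trans
        (Nystrom.sum_spikedWeight_tail hqr.le hr t)
      have hsup := (le_iSup (fun H : {H : Matrix (Fin n) (Fin n) 𝕜 // H.PosSemidef ∧ H.rank = r} =>
        (((∫ ω, Nystrom.nystromError H.1 (Ω ω) ∂P) / Nystrom.optimalError q H.1 : ℝ) : EReal))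
        ⟨_, hpsd, hrk⟩).trans hx1.le
      rwa [EReal.coe_le_coe_iff, hopt, div_le_iff₀ hqr'] at hsup
    have hbound (t : ℕ) (ht : 1 ≤ t) :
        Nystrom.expectedError (Nystrom.randomRotation (P.map Ω)) (Nystrom.spikedWeight n q r t) ≤
          ENNReal.ofReal (x * ((r : ℝ) - q)) := by
      have hc := Nystrom.spikedWeight_nonneg n q r t.cast_nonneg
      refine Nystrom.expectedError_randomRotation_le hc fun U hU => ?_
      rw [← Nystrom.ofReal_integral_nystromError hm (Nystrom.posSemidef_unitary_conj_diagonal hc U)]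
      exact ENNReal.ofReal_le_ofReal (hint t ht U hU)
    have hlim := (Nystrom.isUnitaryInvariant_randomRotation
      (P.map Ω)).tendsto_expectedError_spikedWeight
      (Nystrom.ae_rank_randomRotation hrank) hα hle hr
    have hle' := le_of_tendsto hlim (Filter.eventually_atTop.2 ⟨1, hbound⟩)
    -- Needed because `ENNReal.ofReal` truncates negative numbers to 0; any one conjugate, here t =
    -- 1 and U = 1, shows it.
    have hx0 : 0 ≤ x * ((r : ℝ) - q) :=
      (integral_nonneg fun ω => Nystrom.nystromError_nonneg
        (Nystrom.posSemidef_unitary_conj_diagonal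
          (Nystrom.spikedWeight_nonneg n q r (Nat.cast_nonneg 1)) 1) (Ω ω)).trans
        (hint 1 le_rfl 1 (one_mem _))
    rw [ENNReal.ofReal_le_ofReal_iff hx0] at hle'
    exact absurd (le_of_mul_le_mul_right hle' hqr') hx2.not_ge
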